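/- A \emph{marked simplicial set} is a pair $(A,E_A)$ of a simplicial set $A$ and a set $E_A\subseteq A_1$ of edges containing all degenerate ones; morphisms, forming the category $\mathbf{sSet}^+$, are maps of simplicial sets preserving marked edges. $X^\flat$ (resp. $X^\sharp$) denotes $X$ with exactly the degenerate (resp. all) edges marked. Let $I\otimes X=(\Delta^1)^\sharp\times X$, with endpoint inclusions $\partial_0,\partial_1\colon X\to I\otimes X$ at the vertices $0,1$ of $\Delta^1$ and projection $\sigma\colon I\otimes X\to X$. For $i\colon K\to L$ write $\partial_\varepsilon\boxtimes i\colon L\sqcup_K (I\otimes K)\to I\otimes L$ (the pushout being formed along $\partial_\varepsilon$) and $\partial I\boxtimes i\colon (L\sqcup L)\sqcup_{K\sqcup K}(I\otimes K)\to I\otimes L$ for the induced maps. Let $\Lambda^r$ be the smallest set of morphisms of $\mathbf{sSet}^+$, closed under $i\mapsto \partial I\boxtimes i$, that contains \begin{itemize} \item $(\Lambda^n_k)^\flat\to(\Delta^n)^\flat$ for $n\ge 2$, $0<k<n$, and $J^\flat\to J^\sharp$, where $J$ is the nerve of the free walking isomorphism; \item $\partial_1\boxtimes i$ for $i$ one of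 the maps $(\partial\Delta^n)^\flat\to(\Delta^n)^\flat$, $n\ge 0$, or $(\Delta^1)^\flat\to(\Delta^1)^\sharp$. \end{itemize} \emph{Marked right fibrations} are the maps with the right lifting property against $\Lambda^r$, and \emph{marked right anodyne extensions} are the maps with the left lifting property against all marked right fibrations. \emph{Marked left} fibrations and anodyne extensions are defined in the same way with $\partial_0$ in place of $\partial_1$. Let $(A,E_A)$ be a marked simplicial set. The cylinder induces a cylinder $I_A$ on $\mathbf{sSet}^+/(A,E_A)$, sending $p\colon X\to A$ to $p\sigma\colon I\otimes X\to A$. For objects $X,W$ over $(A,E_A)$ let $[X,W]_{I_A}$ be the quotient of the set of morphisms $X\to W$ over $(A,E_A)$ by the equivalence relation generated by $f\sim g$ whenever there is a morphism $h\colon I_A\otimes X\to W$ over $(A,E_A)$ with $h\partial_0=f$ and $h\partial_1=g$. A right anodyne extension (resp. right fibration) in $\mathbf{sSet}^+/(A,E_A)$ is a morphism whose underlying morphism in $\mathbf{sSet}^+$ is a marked right anodyne extension (resp. a morphism with the right lifting property in $\mathbf{sSet}^+/(A,E_A)$ against these), and an object is right fibrant if its map to the terminal object is a right fibration; similarly for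 left. \textbf{Theorem.} For every marked simplicial set $(A,E_A)$ there is a (Contravariant, or Cartesian) model structure on $\mathbf{sSet}^+/(A,E_A)$ such that \begin{enumerate} \item the cofibrations are exactly the morphisms whose underlying map of simplicial sets is a monomorphism; \item a morphism $f\colon X\to Y$ is a weak equivalence if and only if $f^*\colon[Y,W]_{I_A}\to[X,W]_{I_A}$ is bijective for every right fibrant object $W$; \item an object is fibrant if and only if it is right fibrant, and also if and only if its structure map to $(A,E_A)$ is a marked right fibration; \item a morphism between right fibrant objects is a fibration if and only if it is a right fibration. \end{enumerate} This model structure is the only one with cofibrations and weak equivalences as in (1) and (2), and also the only one with cofibrations as in (1) whose fibrant objects are those whose structure map is a marked right fibration. Dually, the same holds with `left' in place of `right' throughout, giving the Covariant (coCartesian) model structure. -/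

import Mathlib

open CategoryTheory Limits HomotopicalAlgebra

universe v u

namespace DirectedHomotopy

section Cylinder

/-- The data of a functorial cylinder `(I, ∂₀, ∂₁, σ)` on a category: an endofunctor with two
endpoint inclusions `X ⟶ I X` and a common retraction `I X ⟶ X` of them. -/
structure FunctorialCylinder (C : Type u) [Category.{v} C] where
  /-- the cylinder functor `I ⊗ -` -/
  I : C ⥤ C
  /-- the inclusion `{0} ⊗ X ⟶ I ⊗ X` -/
  d₀ : 𝟭 C ⟶ I
  /-- the inclusion `{1} ⊗ X ⟶ I ⊗ X` -/
  d₁ : 𝟭 C ⟶ I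
  /-- the projection -/
  σ : I ⟶ 𝟭 C
  d₀_σ : d₀ ≫ σ = 𝟙 (𝟭 C)
  d₁_σ : d₁ ≫ σ = 𝟙 (𝟭 C)

variable {C : Type u} [Category.{v} C]

/-- For a natural transformation `η : F ⟶ G` of endofunctors and a morphism `i : K ⟶ L`, the
corner map `η ⊠ i : F L ⊔_{F K} G K ⟶ G L`. -/
noncomputable def boxMap [HasPushouts C] {F G : C ⥤ C} (η : F ⟶ G) {K L : C} (i : K ⟶ L) :
    pushout (F.map i) (η.app K) ⟶ G.obj L :=
  pushout.desc (η.app L) (G.map i) (η.naturality i)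

/-- The functor `∂I = id ⊔ id`. -/
noncomputable def twoCopies (C : Type u) [Category.{v} C] [HasBinaryCoproducts C] : C ⥤ C where
  obj X := X ⨿ X
  map f := coprod.map f f

namespace FunctorialCylinder

variable (cyl : FunctorialCylinder C)

/-- The natural transformation `∂₀ ⊔ ∂₁ : ∂I ⟶ I`. -/
noncomputable def boundary [HasBinaryCoproducts C] : twoCopies C ⟶ cyl.I where
  app X := coprod.desc (cyl.d₀.app X) (cyl.d₁.app X)
  naturality X Y f := by
    have h₀ := cyl.d₀.naturality f
    have h₁ := cyl.d₁.naturality f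
    dsimp [twoCopies] at h₀ h₁ ⊢
    apply coprod.hom_ext
    · rw [coprod.inl_map_assoc, coprod.inl_desc, coprod.inl_desc_assoc, h₀]
    · rw [coprod.inr_map_assoc, coprod.inr_desc, coprod.inr_desc_assoc, h₁]

/-- The union over `n` of the sets `Λⁿ`, where `Λ⁰` consists of `S` and of the maps `d ⊠ i` for
`i` in `M`, and `Λⁿ⁺¹` consists of the maps `∂I ⊠ i` for `i` in `Λⁿ`. Here `d` is one of the two
endpoint inclusions. -/
inductive anodyneGenerators [HasPushouts C] [HasBinaryCoproducts C] (d : 𝟭 C ⟶ cyl.I)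
    (S M : MorphismProperty C) : MorphismProperty C where
  | of {K L : C} (i : K ⟶ L) (hi : S i) : anodyneGenerators d S M i
  | endpoint {K L : C} (i : K ⟶ L) (hi : M i) : anodyneGenerators d S M (boxMap d i)
  | boundary {K L : C} (i : K ⟶ L) (hi : anodyneGenerators d S M i) :
      anodyneGenerators d S M (boxMap cyl.boundary i)

/-- The right `I`-anodyne extensions generated by `S`, where `M` is a generating set of
cofibrations. -/
def rightAnodyne [HasPushouts C] [HasBinaryCoproducts C] (S M : MorphismProperty C) :
    MorphismProperty C :=
  (cyl.anodyneGenerators cyl.d₁ S M).rlp.llp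

/-- The left `I`-anodyne extensions generated by `S`, where `M` is a generating set of
cofibrations. -/
def leftAnodyne [HasPushouts C] [HasBinaryCoproducts C] (S M : MorphismProperty C) :
    MorphismProperty C :=
  (cyl.anodyneGenerators cyl.d₀ S M).rlp.llp

/-- There is an `I`-homotopy from `f` to `g`. -/
def Homotopic {X Y : C} (f g : X ⟶ Y) : Prop :=
  ∃ h : cyl.I.obj X ⟶ Y, cyl.d₀.app X ≫ h = f ∧ cyl.d₁.app X ≫ h = g

/-- The set `[X, Y]_I`: the quotient of `X ⟶ Y` by the equivalence relation generated by
`I`-homotopy. -/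
def HomotopyClasses (X Y : C) : Type v :=
  Quot (cyl.Homotopic (X := X) (Y := Y))

/-- The map `f^* : [B, W]_I → [A, W]_I`. -/
def precomp {A B : C} (f : A ⟶ B) (W : C) :
    cyl.HomotopyClasses B W → cyl.HomotopyClasses A W :=
  Quot.map (fun g => f ≫ g) (by
    rintro _ _ ⟨h, rfl, rfl⟩
    have h₀ := cyl.d₀.naturality f
    have h₁ := cyl.d₁.naturality f
    dsimp at h₀ h₁
    exact ⟨cyl.I.map f ≫ h, by rw [← Category.assoc, ← h₀, Category.assoc],
      by rw [← Category.assoc, ← h₁, Category.assoc]⟩)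

/-- The maps `f : A ⟶ B` such that `f^* : [B, W]_I → [A, W]_I` is bijective for each object `W`
whose map to the terminal object has the right lifting property against the class `An`. -/
def equivalences [HasTerminal C] (An : MorphismProperty C) : MorphismProperty C :=
  fun _ _ f => ∀ W : C, An.rlp (terminal.from W) → Function.Bijective (cyl.precomp f W)

/-- The cylinder on `C / A` induced by a cylinder on `C`: it sends `p : X ⟶ A` to
`I ⊗ X ⟶ X ⟶ A`. -/
def overCylinder (A : C) : FunctorialCylinder (Over A) where
  I :=
    { obj := fun X => Over.mk (cyl.σ.app X.left ≫ X.hom)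
      map := fun {X Y} f => Over.homMk (cyl.I.map f.left) (by
        have h := cyl.σ.naturality f.left
        dsimp at h ⊢
        rw [← Category.assoc, h, Category.assoc, Over.w f])
      map_id := fun X => by ext; simp
      map_comp := fun f g => by ext; simp }
  d₀ :=
    { app := fun X => Over.homMk (cyl.d₀.app X.left) (by
        have h := NatTrans.congr_app cyl.d₀_σ X.left
        dsimp at h ⊢
        rw [← Category.assoc, h, Category.id_comp])
      naturality := fun X Y f => by ext; exact cyl.d₀.naturality f.left }
  d₁ :=
    { app := fun X => Over.homMk (cyl.d₁.app X.left) (by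
        have h := NatTrans.congr_app cyl.d₁_σ X.left
        dsimp at h ⊢
        rw [← Category.assoc, h, Category.id_comp])
      naturality := fun X Y f => by ext; exact cyl.d₁.naturality f.left }
  σ :=
    { app := fun X => Over.homMk (cyl.σ.app X.left) rfl
      naturality := fun X Y f => by ext; exact cyl.σ.naturality f.left }
  d₀_σ := by ext X; exact NatTrans.congr_app cyl.d₀_σ X.left
  d₁_σ := by ext X; exact NatTrans.congr_app cyl.d₁_σ X.left

end FunctorialCylinder

/-- The cofibrations of a model structure. -/
abbrev cofibrationsOf (M : ModelCategory C) : MorphismProperty C :=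
  M.categoryWithCofibrations.cofibrations

/-- The fibrations of a model structure. -/
abbrev fibrationsOf (M : ModelCategory C) : MorphismProperty C :=
  M.categoryWithFibrations.fibrations

/-- The weak equivalences of a model structure. -/
abbrev weakEquivalencesOf (M : ModelCategory C) : MorphismProperty C :=
  M.categoryWithWeakEquivalences.weakEquivalences

/-- The model structure `M` is the one described by a cylinder, a class `L` of cofibrations and a
class `An` of (right or left) anodyne extensions. -/
structure IsInducedModelStructure [HasTerminal C] (cyl : FunctorialCylinder C)
    (L An : MorphismProperty C) (M : ModelCategory C) : Prop where
  cofibrations_eq : cofibrationsOf M = L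
  weakEquivalences_eq : weakEquivalencesOf M = cyl.equivalences An
  fibrant_iff : ∀ X : C, fibrationsOf M (terminal.from X) ↔ An.rlp (terminal.from X)
  fibration_iff : ∀ {X Y : C} (f : X ⟶ Y), An.rlp (terminal.from X) → An.rlp (terminal.from Y) →
    (fibrationsOf M f ↔ An.rlp f)

end Cylinder

section Marked

open Simplicial MonoidalCategory

/-- A marked simplicial set: a simplicial set with a set of edges containing the degenerate
ones. -/
structure MarkedSSet where
  /-- the underlying simplicial set -/
  toSSet : SSet.{u}
  /-- the marked edges -/
  marked : Set (toSSet _⦋1⦌)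
  degenerate_subset : toSSet.degenerate 1 ⊆ marked


namespace MarkedSSet

/-- A morphism of marked simplicial sets: a morphism of simplicial sets preserving the marked
edges. -/
@[ext]
structure Hom (X Y : MarkedSSet.{u}) where
  /-- the underlying morphism of simplicial sets -/
  hom : X.toSSet ⟶ Y.toSSet
  map_marked : ∀ e ∈ X.marked, hom.app _ e ∈ Y.marked

instance : Category MarkedSSet.{u} where
  Hom := Hom
  id X := ⟨𝟙 X.toSSet, fun _ he => he⟩
  comp f g := ⟨f.hom ≫ g.hom, fun e he => g.map_marked _ (f.map_marked e he)⟩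

@[ext]
theorem hom_ext {X Y : MarkedSSet.{u}} {f g : X ⟶ Y} (h : f.hom = g.hom) : f = g :=
  Hom.ext h

/-- The forgetful functor to simplicial sets. -/
@[simps]
def forget : MarkedSSet.{u} ⥤ SSet.{u} where
  obj X := X.toSSet
  map f := f.hom

/-- The marked simplicial set `X^♭`: only the degenerate edges are marked. -/
def flat (X : SSet.{u}) : MarkedSSet.{u} := ⟨X, X.degenerate 1, subset_rfl⟩

/-- The marked simplicial set `X^♯`: all edges are marked. -/
def sharp (X : SSet.{u}) : MarkedSSet.{u} := ⟨X, Set.univ, Set.subset_univ _⟩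

/-- The morphism `f^♭ : X^♭ ⟶ Y^♭`. -/
def flatMap {X Y : SSet.{u}} (f : X ⟶ Y) : flat X ⟶ flat Y :=
  ⟨f, fun _ he => SSet.degenerate_app_apply he f⟩

/-- The canonical morphism `X^♭ ⟶ X^♯`. -/
def flatToSharp (X : SSet.{u}) : flat X ⟶ sharp X := ⟨𝟙 X, fun _ _ => Set.mem_univ _⟩

/-- The product: an edge is marked if and only if both components are. -/
def prod (X Y : MarkedSSet.{u}) : MarkedSSet.{u} where
  toSSet := X.toSSet ⊗ Y.toSSet
  marked := {e | e.1 ∈ X.marked ∧ e.2 ∈ Y.marked}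
  degenerate_subset _ he :=
    ⟨X.degenerate_subset (SSet.degenerate_app_apply he (SemiCartesianMonoidalCategory.fst _ _)),
      Y.degenerate_subset (SSet.degenerate_app_apply he (SemiCartesianMonoidalCategory.snd _ _))⟩

/-- The inclusion `X ⟶ (Δ¹)^♯ × X` at a vertex `k` of `Δ¹`. -/
def vertexInclusion (k : Fin 2) (X : MarkedSSet.{u}) : X ⟶ prod (sharp Δ[1]) X where
  hom := CartesianMonoidalCategory.lift
    (SSet.const (SSet.stdSimplex.obj₀Equiv.symm k)) (𝟙 X.toSSet)
  map_marked _ he := ⟨Set.mem_univ _, he⟩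

/-- The cylinder `(Δ¹)^♯ × -` on marked simplicial sets. -/
def cylinder : FunctorialCylinder MarkedSSet.{u} where
  I :=
    { obj := fun X => prod (sharp Δ[1]) X
      map := fun f => ⟨Δ[1] ◁ f.hom, fun _ he => ⟨he.1, f.map_marked _ he.2⟩⟩
      map_id := fun _ => rfl
      map_comp := fun _ _ => rfl }
  d₀ := { app := vertexInclusion 0, naturality := fun _ _ _ => rfl }
  d₁ := { app := vertexInclusion 1, naturality := fun _ _ _ => rfl }
  σ :=
    { app := fun _ => ⟨SemiCartesianMonoidalCategory.snd _ _, fun _ he => he.2⟩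
      naturality := fun _ _ _ => rfl }
  d₀_σ := rfl
  d₁_σ := rfl

/-- The morphisms whose underlying morphism of simplicial sets is a monomorphism. -/
def underlyingMono : MorphismProperty MarkedSSet.{u} :=
  (MorphismProperty.monomorphisms SSet.{u}).inverseImage forget

section Colimits

variable {J : Type*} [Category J] [HasColimitsOfShape J SSet.{u}] (F : J ⥤ MarkedSSet.{u})

/-- The colimit of a diagram of marked simplicial sets, computed on underlying simplicial sets. -/
noncomputable def colimitCocone : Cocone F where
  pt :=
    { toSSet := colimit (F ⋙ forget)
      marked := (colimit (F ⋙ forget)).degenerate 1 ∪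
        {e | ∃ (j : J) (e' : (F.obj j).toSSet _⦋1⦌), e' ∈ (F.obj j).marked ∧
          (colimit.ι (F ⋙ forget) j).app _ e' = e}
      degenerate_subset := Set.subset_union_left }
  ι :=
    { app := fun j => ⟨colimit.ι (F ⋙ forget) j, fun e he => Or.inr ⟨j, e, he, rfl⟩⟩
      naturality := fun i j f => by
        apply hom_ext
        exact (colimit.w (F ⋙ forget) f).trans (Category.comp_id _).symm }

/-- The cocone `colimitCocone F` is a colimit. -/
noncomputable def isColimitColimitCocone : IsColimit (colimitCocone F) where
  desc s := ⟨colimit.desc (F ⋙ forget) (forget.mapCocone s), by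
    rintro e (he | ⟨j, e', he', rfl⟩)
    · exact s.pt.degenerate_subset (SSet.degenerate_app_apply he _)
    · have h := (s.ι.app j).map_marked e' he'
      have h' := colimit.ι_desc (forget.mapCocone s) j
      have h'' : (colimit.desc (F ⋙ forget) (forget.mapCocone s)).app _
          ((colimit.ι (F ⋙ forget) j).app _ e') = (s.ι.app j).hom.app _ e' := by
        change (colimit.ι (F ⋙ forget) j ≫ colimit.desc (F ⋙ forget) (forget.mapCocone s)).app _ e'
          = _
        rw [h']
        rfl
      exact h''.symm ▸ h⟩
  fac s j := hom_ext (colimit.ι_desc (forget.mapCocone s) j)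
  uniq s m hm := hom_ext (colimit.hom_ext fun j => by
    refine Eq.trans ?_ (colimit.ι_desc (forget.mapCocone s) j).symm
    exact congrArg Hom.hom (hm j))

instance : HasColimitsOfShape J MarkedSSet.{u} where
  has_colimit F := ⟨⟨⟨colimitCocone F, isColimitColimitCocone F⟩⟩⟩

end Colimits

end MarkedSSet

end Marked

namespace MarkedSSet

/-- The generating set of `underlyingMono`: the maps `(∂Δⁿ)^♭ ⟶ (Δⁿ)^♭` for `n ≥ 0` and
`(Δ¹)^♭ ⟶ (Δ¹)^♯`. -/
inductive generatingMono : MorphismProperty MarkedSSet.{u} where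
  | boundary (n : ℕ) : generatingMono (flatMap (SSet.boundary.{u} n).ι)
  | edge : generatingMono (flatToSharp (SSet.stdSimplex.{u}.obj (SimplexCategory.mk 1)))

/-- The maps `(Λⁿₖ)^♭ ⟶ (Δⁿ)^♭` for `n ≥ 2` and `0 < k < n`, and `J^♭ ⟶ J^♯` for `J` the nerve of
the free walking isomorphism. -/
inductive innerHornsAndJ : MorphismProperty MarkedSSet.{u} where
  | horn (n : ℕ) (k : Fin (n + 1)) (hn : 2 ≤ n) (h₀ : 0 < k) (h₁ : k < Fin.last n) :
      innerHornsAndJ (flatMap (SSet.horn.{u} n k).ι)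
  | J : innerHornsAndJ (flatToSharp SSet.coherentIso.{u})

/-- The marked right anodyne extensions. -/
noncomputable def markedRightAnodyne : MorphismProperty MarkedSSet.{u} :=
  cylinder.{u}.rightAnodyne innerHornsAndJ.{u} generatingMono.{u}

/-- The marked left anodyne extensions. -/
noncomputable def markedLeftAnodyne : MorphismProperty MarkedSSet.{u} :=
  cylinder.{u}.leftAnodyne innerHornsAndJ.{u} generatingMono.{u}

end MarkedSSet

end DirectedHomotopy

-- The proof combines Cisinski's theory of anodyne extensions with an argument in the style of
-- Smith's theorem for the existence of a small set of generating trivial cofibrations. Let `L` be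
-- the cofibrations and `An` the anodyne extensions; every object is cofibrant.
--
-- Lifting against `∂₁ ⊠ i` for `i` in `L` makes homotopy an equivalence relation on maps into an
-- object `W` that is fibrant with respect to `An`, and lifting against `∂I ⊠ i` for `i` in `An`
-- makes anodyne extensions weak equivalences. The central lemma is `rlp_of_equivalences`: an
-- `An`-fibration with fibrant target that is a weak equivalence lifts against all of `L`. It yields
-- `equivalences_iff_hasLiftingProperty`: a cofibration is a weak equivalence exactly when it lifts
-- against the `An`-fibrations with fibrant target. Hence these maps are fibrations, which gives the
-- description of fibrant objects and of fibrations between them.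
--
-- What remains is the factorization into a trivial cofibration and a fibration. An accessible
-- functor `R` on arrows replaces each arrow by an `An`-fibration with fibrant target. An arrow `W`
-- is then a weak equivalence if and only if `R W` is injective with respect to a small family of
-- squares. A class defined in this way has a solution set (`exists_solutionSet`), and factorizing
-- through its members produces a small set generating the trivial cofibrations
-- (`exists_small_generators`).
--
-- Uniqueness given the weak equivalences is formal. Given only the fibrant objects, it holds
-- because the cofibrations alone determine homotopy of maps into a fibrant object, through
-- cylinders whose projection is a trivial fibration, and weak equivalences are detected by homotopy
-- classes of maps into fibrant objects.
--
-- All hypotheses are lifting statements, so they pass to slices. For marked simplicial sets one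
-- checks local presentability, that the cylinder has a right adjoint (the path object), that
-- monomorphisms are generated by a small set, and that the corner maps preserve them. The left case
-- uses the cylinder with its ends exchanged.

universe w

namespace DirectedHomotopy

/-! ### Presentability ranks and the small object argument. -/

section Presentable

variable (C : Type u) [Category.{w} C] [IsLocallyPresentable.{w} C]

theorem exists_isRegular_and_isCardinalPresentable {ι : Type w} (X : ι → C) (κ₀ : Cardinal.{w}) :
    ∃ (κ : Cardinal.{w}) (_ : Fact κ.IsRegular), κ₀ ≤ κ ∧ IsCardinalLocallyPresentable C κ ∧
      ∀ i, IsCardinalPresentable (X i) κ := by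
  obtain ⟨κ₁, _, h₁⟩ := IsLocallyPresentable.exists_cardinal.{w} C
  have h (i : ι) : ∃ (κ : Cardinal.{w}) (_ : Fact κ.IsRegular), IsCardinalPresentable (X i) κ :=
    (inferInstance : IsPresentable.{w} (X i)).exists_cardinal
  choose c hc hX using h
  let T : Option (Option ι) → Type w
    | none => κ₀.out
    | some none => κ₁.out
    | some (some i) => (c i).out
  obtain ⟨κ, hκ, h⟩ := HasCardinalLT.exists_regular_cardinal_forall.{w} T
  have : Fact κ.IsRegular := ⟨hκ⟩
  have h' (j) : Cardinal.mk (T j) ≤ κ := ((hasCardinalLT_iff_cardinal_mk_lt _ _).1 (h j)).le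
  refine ⟨κ, inferInstance, ?_, ?_, fun i => ?_⟩
  · simpa [T] using h' none
  · exact IsCardinalLocallyPresentable.of_le C (κ := κ₁) (by simpa [T] using h' (some none))
  · have := hX i
    exact isCardinalPresentable_of_le _ (κ := c i) (by simpa [T] using h' (some (some i)))

variable {C}

theorem hasSmallObjectArgument_of_isSmall (I : MorphismProperty C)
    [MorphismProperty.IsSmall.{w} I] : MorphismProperty.HasSmallObjectArgument.{w} I := by
  obtain ⟨κ, _, -, _, h⟩ := exists_isRegular_and_isCardinalPresentable C
    (fun i : Shrink.{w} I.toSet => ((equivShrink I.toSet).symm i).1.left) 0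
  have : Nonempty κ.ord.ToType := by simpa using (Fact.out : κ.IsRegular).ne_zero
  have := WellFoundedLT.toOrderBot κ.ord.ToType
  refine ⟨κ, inferInstance, inferInstance, { preservesColimit {A B X Y} i hi f hf := ?_ }⟩
  have := h (equivShrink I.toSet ⟨Arrow.mk i, hi⟩)
  simp only [Equiv.symm_apply_apply, Arrow.mk_left] at this
  have := preservesColimitsOfShape_of_isCardinalPresentable A κ κ.ord.ToType
  infer_instance

end Presentable

/-! ### Accessible functorial injective replacement. -/

section InjectiveReplacement

variable {C : Type u} [Category.{w} C] [HasColimitsOfSize.{w, w} C]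
  {K : Type w} {a b : K → C} (f : ∀ k, a k ⟶ b k)

/-- The functor sending `X` to the coproduct of copies of `b k` indexed by all morphisms
`a k ⟶ X` for varying `k`. -/
noncomputable def cellFunctor (a b : K → C) : C ⥤ C :=
  ∐ fun k => coyoneda.obj (Opposite.op (a k)) ⋙ sigmaConst.obj (b k)

/-- The attaching map of all cells. -/
noncomputable def cellFunctorMap : cellFunctor a a ⟶ cellFunctor a b :=
  Limits.Sigma.map fun k => Functor.whiskerLeft _ (sigmaConst.map (f k))

/-- The evaluation from the coproduct of all morphisms `a k ⟶ X` to `X`. -/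
noncomputable def cellFunctorEval (a : K → C) : cellFunctor a a ⟶ 𝟭 C :=
  Sigma.desc fun k => (sigmaConstAdj (a k)).counit

/-- The functor which attaches to `X` a copy of `f k` for each morphism `a k ⟶ X`. -/
noncomputable def attachCells : C ⥤ C :=
  pushout (cellFunctorMap f) (cellFunctorEval a)

/-- The inclusion of `X` into the result of attaching all cells. -/
noncomputable def toAttachCells : 𝟭 C ⟶ attachCells f :=
  pushout.inr _ _

theorem exists_extension_attachCells (k : K) {X : C} (g : a k ⟶ X) :
    ∃ g' : b k ⟶ (attachCells f).obj X, f k ≫ g' = g ≫ (toAttachCells f).app X := by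
  have h := NatTrans.congr_app (pushout.condition (f := cellFunctorMap f)
    (g := cellFunctorEval a)) X
  have h₁ := NatTrans.congr_app (Sigma.ι_map
    (f := fun k => coyoneda.obj (Opposite.op (a k)) ⋙ sigmaConst.obj (a k))
    (g := fun k => coyoneda.obj (Opposite.op (a k)) ⋙ sigmaConst.obj (b k))
    (fun k => Functor.whiskerLeft _ (sigmaConst.map (f k))) k) X
  have h₂ := NatTrans.congr_app (Sigma.ι_desc
    (f := fun k => coyoneda.obj (Opposite.op (a k)) ⋙ sigmaConst.obj (a k))
    (fun k => (sigmaConstAdj (a k)).counit) k) X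
  refine ⟨Sigma.ι (fun _ : a k ⟶ X => b k) g ≫
    (Sigma.ι (fun k => coyoneda.obj (Opposite.op (a k)) ⋙ sigmaConst.obj (b k)) k).app X ≫
    (pushout.inl (cellFunctorMap f) (cellFunctorEval a)).app X, ?_⟩
  have e₁ : f k ≫ Sigma.ι (fun _ : a k ⟶ X => b k) g =
      Sigma.ι (fun _ : a k ⟶ X => a k) g ≫ (sigmaConst.map (f k)).app (a k ⟶ X) := by
    simp [sigmaConst]
  have e₂ : Sigma.ι (fun _ : a k ⟶ X => a k) g ≫ (sigmaConstAdj (a k)).counit.app X = g := by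
    simp [sigmaConstAdj]
  rw [reassoc_of% e₁]
  dsimp at h h₁ h₂
  erw [reassoc_of% h₁.symm]
  erw [h]
  erw [reassoc_of% h₂]
  exact (Category.assoc _ _ _).symm.trans (congrArg (· ≫ _) e₂)

/-- Evaluated at `X`, the inclusion is a cobase change of a coproduct of copies of the maps `f k`,
and left lifting classes are stable under both operations. -/
theorem llp_toAttachCells (X : C) :
    (MorphismProperty.ofHoms f).rlp.llp ((toAttachCells f).app X) := by
  let W := (MorphismProperty.ofHoms f).rlp.llp
  have h : W.functorCategory C (cellFunctorMap f) := by
    refine MorphismProperty.colimMap (W := W.functorCategory C) _ (fun k Y => ?_)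
    refine MorphismProperty.colimMap (W := W) _ (fun _ => ?_)
    exact MorphismProperty.le_llp_rlp _ _ ⟨k.as⟩
  exact (W.functorCategory C).of_isPushout (IsPushout.of_hasPushout _ _).flip h X

variable (κ : Cardinal.{w}) [Fact κ.IsRegular]

set_option linter.unusedSectionVars false in
-- Colimits of functors are computed pointwise and commute with the colimits to be preserved.
theorem isCardinalAccessible_of_isColimit {J : Type*} [Category J] [HasColimitsOfShape J C]
    {F : J ⥤ C ⥤ C} {c : Cocone F} (hc : IsColimit c)
    (h : ∀ j, (F.obj j).IsCardinalAccessible κ) : c.pt.IsCardinalAccessible κ where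
  preservesColimitOfShape S _ _ := by
    have (j : J) : PreservesColimitsOfShape S (F.obj j) :=
      (F.obj j).preservesColimitsOfShape_of_isCardinalAccessible κ S
    refine ⟨fun {Y} => ⟨fun {s} hs => ⟨?_⟩⟩⟩
    let hc' (X : C) := isColimitOfPreserves ((evaluation C C).obj X) hc
    let hs' (j : J) := isColimitOfPreserves (F.obj j) hs
    let t' (t : Cocone (Y ⋙ c.pt)) (j : J) : Cocone (Y ⋙ F.obj j) :=
      (Cocone.precompose (Functor.whiskerLeft Y (c.ι.app j))).obj t
    have fac (t j i) : (F.obj j).map (s.ι.app i) ≫ (hs' j).desc (t' t j) =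
      (c.ι.app j).app (Y.obj i) ≫ t.ι.app i := (hs' j).fac (t' t j) i
    let t'' (t : Cocone (Y ⋙ c.pt)) : Cocone (F ⋙ (evaluation C C).obj s.pt) :=
      { pt := t.pt
        ι :=
          { app := fun j => (hs' j).desc (t' t j)
            naturality := fun j j' u => (hs' j).hom_ext fun i => by
              have h₁ := NatTrans.congr_app (c.w u) (Y.obj i)
              have h₂ := (F.map u).naturality (s.ι.app i)
              dsimp at h₁ h₂ ⊢
              rw [Category.comp_id, reassoc_of% h₂, fac, fac, reassoc_of% h₁] } }
    have fac' (t j) : (c.ι.app j).app s.pt ≫ (hc' s.pt).desc (t'' t) = (hs' j).desc (t' t j) :=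
      (hc' s.pt).fac (t'' t) j
    exact
      { desc t := (hc' s.pt).desc (t'' t)
        fac t i := (hc' (Y.obj i)).hom_ext fun j => by
          have h := (c.ι.app j).naturality (s.ι.app i)
          dsimp at h ⊢
          rw [← reassoc_of% h, fac', fac]
        uniq t m hm := (hc' s.pt).hom_ext fun j => (hs' j).hom_ext fun i => by
          have h := (c.ι.app j).naturality (s.ι.app i)
          dsimp at h hm ⊢
          rw [fac', fac, reassoc_of% h, hm] }

theorem isCardinalAccessible_cellFunctor (a b : K → C) [∀ k, IsCardinalPresentable (a k) κ] :
    (cellFunctor a b).IsCardinalAccessible κ :=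
  isCardinalAccessible_of_isColimit κ (colimit.isColimit _) (fun k => by
    dsimp
    infer_instance)

theorem isCardinalAccessible_attachCells [∀ k, IsCardinalPresentable (a k) κ] :
    (attachCells f).IsCardinalAccessible κ :=
  isCardinalAccessible_of_isColimit κ (colimit.isColimit _) (by
    have := isCardinalAccessible_cellFunctor κ a a
    have := isCardinalAccessible_cellFunctor κ a b
    rintro (_ | _ | _) <;> dsimp <;> infer_instance)

/-- The functor is the `κ`-fold iterate of `attachCells f`. Accessibility passes through successor
and limit stages by transfinite induction. -/
theorem exists_injectiveReplacement [∀ k, IsCardinalPresentable (a k) κ] :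
    ∃ (R : C ⥤ C) (η : 𝟭 C ⟶ R), R.IsCardinalAccessible κ ∧
      (∀ X, (MorphismProperty.ofHoms f).rlp.llp (η.app X)) ∧
      ∀ X k (g : a k ⟶ R.obj X), ∃ g' : b k ⟶ R.obj X, f k ≫ g' = g := by
  have : Nonempty κ.ord.ToType := by simpa using (Fact.out : κ.IsRegular).ne_zero
  have := WellFoundedLT.toOrderBot κ.ord.ToType
  have := Cardinal.noMaxOrder (Fact.elim inferInstance : κ.IsRegular).aleph0_le
  let Φ := SmallObject.SuccStruct.ofNatTrans (toAttachCells f)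
  let H := Φ.transfiniteCompositionOfShapeιIteration κ.ord.ToType
  let S := Φ.iterationFunctor κ.ord.ToType
  have hS (j : κ.ord.ToType) : (S.obj j).IsCardinalAccessible κ := by
    induction j using SuccOrder.limitRecOn with
    | isMin j hj =>
      obtain rfl := hj.eq_bot
      have : Functor.IsCardinalAccessible Φ.X₀ κ :=
        (inferInstance : Functor.IsCardinalAccessible (𝟭 C) κ)
      exact Functor.isCardinalAccessible_of_natIso
        (Φ.iterationFunctorObjBotIso κ.ord.ToType).symm κ
    | succ j hj h =>
      have := isCardinalAccessible_attachCells f κ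
      have : Functor.IsCardinalAccessible (Φ.succ (S.obj j)) κ :=
        (inferInstance : Functor.IsCardinalAccessible (S.obj j ⋙ attachCells f) κ)
      exact Functor.isCardinalAccessible_of_natIso
        (Φ.iterationFunctorObjSuccIso j hj).symm κ
    | isSuccLimit j hj h =>
      exact isCardinalAccessible_of_isColimit κ (S.isColimitOfIsWellOrderContinuous j hj)
        (fun i => h i.1 i.2)
  have hη : ((MorphismProperty.ofHoms f).rlp.llp.functorCategory C)
      (Φ.ιIteration κ.ord.ToType) := by
    refine MorphismProperty.transfiniteCompositionsOfShape_le _ κ.ord.ToType _ ⟨H.ofLE ?_⟩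
    intro (G : C ⥤ C) _ _ h X
    cases h
    exact llp_toAttachCells f (G.obj X)
  refine ⟨Φ.iteration κ.ord.ToType, Φ.ιIteration κ.ord.ToType,
    isCardinalAccessible_of_isColimit κ (Φ.isColimitIterationCocone κ.ord.ToType) hS,
    hη, fun X k g => ?_⟩
  let hX := isColimitOfPreserves ((evaluation C C).obj X) (Φ.isColimitIterationCocone κ.ord.ToType)
  -- The chain is `κ`-filtered and `a k` is `κ`-presentable, so the map lives at some stage `j`; it
  -- is extended at the next stage.
  obtain ⟨j, g, rfl⟩ := IsCardinalPresentable.exists_hom_of_isColimit κ hX g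
  obtain ⟨g', hg'⟩ := exists_extension_attachCells f k g
  have h₁ := NatTrans.congr_app (Φ.iterationFunctor_map_succ j (not_isMax j)) X
  have h₂ := NatTrans.congr_app ((Φ.iterationCocone κ.ord.ToType).w
    (homOfLE (Order.le_succ j))) X
  refine ⟨g' ≫ (Φ.iterationFunctorObjSuccIso j (not_isMax j)).inv.app X ≫
    ((Φ.iterationCocone κ.ord.ToType).ι.app (Order.succ j)).app X, ?_⟩
  rw [reassoc_of% hg']
  refine congrArg (g ≫ ·) (Eq.trans ?_ h₂)
  exact (Category.assoc _ _ _).symm.trans (congrArg (· ≫ _) h₁.symm)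

end InjectiveReplacement

/-! ### A solution set for an injectivity class defined through an accessible functor. -/

section SolutionSet

/-- Terms built from a constant by unary operations indexed by `N` and by operations of arity
less than `κ`. -/
inductive ClosureTerm (κ : Cardinal.{w}) (N : Type w) : Type w
  | base : ClosureTerm κ N
  | sup (S : Set κ.out) (hS : Cardinal.mk S < κ) (x : S → ClosureTerm κ N) : ClosureTerm κ N
  | op (x : ClosureTerm κ N) (n : N) : ClosureTerm κ N

/-- The evaluation of terms. -/
def ClosureTerm.eval {κ : Cardinal.{w}} {N : Type w} {α : Type*} (a : α)
    (sup : ∀ S : Set κ.out, Cardinal.mk S < κ → (S → α) → α) (op : α → N → α) :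
    ClosureTerm κ N → α
  | base => a
  | .sup S hS x => sup S hS fun s => (x s).eval a sup op
  | .op x n => op (x.eval a sup op) n

theorem exists_surjective_of_mk_lt {κ : Cardinal.{w}} {K : Type w} (hK : Cardinal.mk K < κ) :
    ∃ (S : Set κ.out) (_ : Cardinal.mk S < κ) (f : S → K), Function.Surjective f := by
  obtain ⟨e⟩ : Nonempty (K ↪ κ.out) := by
    rw [← Cardinal.le_def]
    simpa using hK.le
  let e' := Equiv.ofInjective e e.injective
  exact ⟨Set.range e, by rwa [← Cardinal.mk_congr e'], e'.symm, e'.symm.surjective⟩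

variable {A : Type u} [Category.{w} A] (κ : Cardinal.{w}) [Fact κ.IsRegular]

theorem exists_directed_colimitPresentation [IsCardinalLocallyPresentable A κ] :
    ∃ (E : Type w) (el : E → A), ∀ X : A, ∃ (α : Type w) (_ : PartialOrder α)
      (_ : IsCardinalFiltered α κ) (D : α ⥤ A) (c : Cocone D) (_ : IsColimit c)
      (_ : c.pt = X), ∀ a, ∃ e, el e = D.obj a := by
  obtain ⟨P, _, hP⟩ := HasCardinalFilteredGenerator.exists_small_generator A κ
  refine ⟨Shrink.{w} (Subtype P), fun e => ((equivShrink _).symm e).1, fun X => ?_⟩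
  obtain ⟨J, _, _, ⟨p⟩⟩ := hP.exists_colimitsOfShape X
  obtain ⟨α, _, _, F, _⟩ := IsCardinalFiltered.exists_cardinal_directed J κ
  exact ⟨α, inferInstance, inferInstance, F ⋙ p.diag, p.cocone.whisker F,
    (Functor.Final.isColimitWhiskerEquiv F p.cocone).symm p.isColimit, rfl,
    fun a => ⟨equivShrink _ ⟨_, p.prop_diag_obj (F.obj a)⟩, by simp⟩⟩

variable {κ} {ι : Type w} {s t : ι → A} (φ : ∀ i, s i ⟶ t i)
  [∀ i, IsCardinalPresentable (s i) κ] [∀ i, IsCardinalPresentable (t i) κ]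

/-- Injectivity of the colimit solves the problem there; presentability of `t i` brings the solution
down to a stage, and presentability of `s i` makes the required equation hold at a later one. -/
theorem exists_le_extension {α : Type w} [PartialOrder α] [IsCardinalFiltered α κ] {D : α ⥤ A}
    {c : Cocone D} (hc : IsColimit c) (hi : ∀ i (g : s i ⟶ c.pt), ∃ g', φ i ≫ g' = g)
    (i : ι) (a : α) (g : s i ⟶ D.obj a) :
    ∃ (a' : α) (h : a ≤ a') (g' : t i ⟶ D.obj a'), φ i ≫ g' = g ≫ D.map (homOfLE h) := by
  have := isFiltered_of_isCardinalFiltered α κ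
  obtain ⟨g', hg'⟩ := hi i (g ≫ c.ι.app a)
  obtain ⟨b, g', rfl⟩ := IsCardinalPresentable.exists_hom_of_isColimit κ hc g'
  obtain ⟨d, u, v, h⟩ := IsCardinalPresentable.exists_eq_of_isColimit κ hc (φ i ≫ g') g
    (by simpa using hg')
  refine ⟨d, leOfHom v, g' ≫ D.map u, ?_⟩
  rw [Subsingleton.elim (homOfLE (leOfHom v)) v]
  simpa using h

/-- A Löwenheim–Skolem argument: `X` is written as a `κ`-directed colimit of objects from a fixed
small family, and a stage through which `x` factors is closed under bounds of fewer than `κ` stages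
and under passing to stages where extension problems are solved. The colimit over the closure is the
required `W ω`. -/
theorem exists_solutionSet [IsCardinalLocallyPresentable A κ] (R : A ⥤ A)
    [R.IsCardinalAccessible κ] {m : Type w} (c : m → A)
    [∀ j, IsCardinalPresentable (c j) κ] :
    ∃ (Ω : Type w) (W : Ω → A),
      (∀ ω i (g : s i ⟶ R.obj (W ω)), ∃ g', φ i ≫ g' = g) ∧
      ∀ (X : A), (∀ i (g : s i ⟶ R.obj X), ∃ g', φ i ≫ g' = g) → ∀ j (x : c j ⟶ X),
        ∃ (ω : Ω) (x' : c j ⟶ W ω) (y : W ω ⟶ X), x' ≫ y = x := by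
  obtain ⟨E, el, hE⟩ := exists_directed_colimitPresentation (A := A) κ
  -- `N` lists all possible extension problems. The terms `T` depend only on `κ` and `N`, not on
  -- `X`, so one small type of diagrams of shape `T` serves for all `X`.
  let N := Σ (e : E) (i : ι), (s i ⟶ R.obj (el e))
  let T := ClosureTerm κ N
  let Ω₀ := Σ (_ : Preorder T), (T ⥤ InducedCategory A el)
  let W₀ : Ω₀ → A := fun ω => letI := ω.1; colimit (ω.2 ⋙ inducedFunctor el)
  refine ⟨{ω : Ω₀ // ∀ i (g : s i ⟶ R.obj (W₀ ω)), ∃ g', φ i ≫ g' = g}, fun ω => W₀ ω.1,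
    fun ω => ω.2, fun X hX j x => ?_⟩
  obtain ⟨α, _, _, D, cD, hc, rfl, hD⟩ := hE X
  have := isFiltered_of_isCardinalFiltered α κ
  choose e he using hD
  obtain ⟨a₀, x₀, rfl⟩ := IsCardinalPresentable.exists_hom_of_isColimit κ hc x
  have := R.preservesColimitsOfShape_of_isCardinalAccessible κ α
  -- The operation must be total: a problem that does not concern the object at stage `a` leaves `a`
  -- unchanged.
  have hop (a : α) (n : N) : ∃ (a' : α) (h : a ≤ a'), ∀ (he : el n.1 = D.obj a),
      ∃ g' : t n.2.1 ⟶ R.obj (D.obj a'),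
        φ n.2.1 ≫ g' = n.2.2 ≫ eqToHom (by rw [he]) ≫ R.map (D.map (homOfLE h)) := by
    by_cases he : el n.1 = D.obj a
    · obtain ⟨a', h, g', hg'⟩ :=
        exists_le_extension (κ := κ) φ (isColimitOfPreserves R hc) hX n.2.1 a
        (n.2.2 ≫ eqToHom (by rw [he]; rfl))
      exact ⟨a', h, fun _ => ⟨g', by simpa using hg'⟩⟩
    · exact ⟨a, le_rfl, fun h => (he h).elim⟩
  choose op le_op hop using hop
  have hsup (S : Set κ.out) (hS : Cardinal.mk S < κ) (f : S → α) : ∃ a, ∀ i, f i ≤ a := by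
    have hS' : HasCardinalLT S κ := (hasCardinalLT_iff_cardinal_mk_lt _ _).2 hS
    exact ⟨IsCardinalFiltered.max (κ := κ) f hS',
      fun i => leOfHom (IsCardinalFiltered.toMax (κ := κ) f hS' i)⟩
  choose sup le_sup using hsup
  let ev : T → α := ClosureTerm.eval a₀ sup op
  -- The order is pulled back along evaluation, so distinct terms with the same value become
  -- isomorphic; the operation `sup` makes `T` `κ`-filtered.
  let _ : Preorder T := Preorder.lift ev
  have hev : Monotone ev := fun _ _ h => h
  have : IsCardinalFiltered T κ := isCardinalFiltered_preorder _ _ fun K f hK => by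
    obtain ⟨S, hS, r, hr⟩ := exists_surjective_of_mk_lt hK
    refine ⟨.sup S hS (f ∘ r), fun k => ?_⟩
    obtain ⟨k, rfl⟩ := hr k
    exact le_sup S hS (fun s => ev (f (r s))) k
  let F : T ⥤ InducedCategory A el :=
    { obj x := e (ev x)
      map {x y} h := ⟨eqToHom (he _) ≫ D.map (homOfLE (hev (leOfHom h))) ≫ eqToHom (he _).symm⟩
      map_id x := by ext; simp
      map_comp f g := by
        ext
        simp [← Functor.map_comp_assoc] }
  let iso : hev.functor ⋙ D ≅ F ⋙ inducedFunctor el :=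
    NatIso.ofComponents (fun x => eqToIso (he (ev x)).symm) (by
      intro x y h
      simp [F]
      rfl)
  let ω : Ω₀ := ⟨inferInstance, F⟩
  let cF : Cocone (hev.functor ⋙ D) :=
    (Cocone.precompose iso.hom).obj (colimit.cocone (F ⋙ inducedFunctor el))
  have hcF : IsColimit cF := (IsColimit.precomposeHomEquiv iso _).symm (colimit.isColimit _)
  have := R.preservesColimitsOfShape_of_isCardinalAccessible κ T
  refine ⟨⟨ω, fun i g => ?_⟩, x₀ ≫ cF.ι.app .base, hcF.desc (cD.whisker hev.functor), ?_⟩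
  · obtain ⟨x, g, rfl⟩ := IsCardinalPresentable.exists_hom_of_isColimit κ
      (isColimitOfPreserves R hcF) g
    have he' := congrArg R.obj (he (ev x))
    -- The map `g`, read as a problem at stage `ev x`, is an element of `N`, and the term `op x n`
    -- was introduced to solve it.
    let n : N := ⟨e (ev x), i, g ≫ eqToHom he'.symm⟩
    obtain ⟨g', hg'⟩ := hop (ev x) n (he (ev x))
    have h : x ≤ ClosureTerm.op x n := le_op (ev x) n
    have key {Y Z Z' : A} (h₁ : Y = Z) (h₂ : Z = Y) (u : s i ⟶ Y) (v : Y ⟶ Z') :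
        (u ≫ eqToHom h₁) ≫ eqToHom h₂ ≫ v = u ≫ v := by simp
    refine ⟨g' ≫ R.map (cF.ι.app (.op x n)), ?_⟩
    rw [reassoc_of% hg']
    refine (key he'.symm he' g _).trans ?_
    have := cF.w (homOfLE h)
    exact congrArg (g ≫ ·) ((R.map_comp _ _).symm.trans (congrArg R.map this))
  · exact (Category.assoc _ _ _).trans (congrArg (x₀ ≫ ·) (hcF.fac _ _))

end SolutionSet

/-! ### Homotopy theory of a cylinder with anodyne extensions. -/

section Cisinski

open MorphismProperty

variable {C : Type u} [Category.{w} C]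

theorem exists_lift {A B X Y : C} {i : A ⟶ B} {p : X ⟶ Y} (h : HasLiftingProperty i p)
    {a : A ⟶ X} {b : B ⟶ Y} (w : a ≫ p = i ≫ b) : ∃ l : B ⟶ X, i ≫ l = a ∧ l ≫ p = b :=
  ⟨(CommSq.mk w).lift, by simp, by simp⟩

namespace FunctorialCylinder

/-- The cylinder with the two endpoints exchanged. -/
def symm (cyl : FunctorialCylinder C) : FunctorialCylinder C where
  I := cyl.I
  d₀ := cyl.d₁
  d₁ := cyl.d₀
  σ := cyl.σ
  d₀_σ := cyl.d₁_σ
  d₁_σ := cyl.d₀_σ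

variable (cyl : FunctorialCylinder C)

@[simp]
theorem d₀_app_σ_app (X : C) : cyl.d₀.app X ≫ cyl.σ.app X = 𝟙 X :=
  NatTrans.congr_app cyl.d₀_σ X

@[simp]
theorem d₀_app_σ_app_assoc {X Z : C} (h : X ⟶ Z) : cyl.d₀.app X ≫ cyl.σ.app X ≫ h = h := by
  rw [reassoc_of% cyl.d₀_app_σ_app X]

@[simp]
theorem d₁_app_σ_app (X : C) : cyl.d₁.app X ≫ cyl.σ.app X = 𝟙 X :=
  NatTrans.congr_app cyl.d₁_σ X

@[simp]
theorem d₁_app_σ_app_assoc {X Z : C} (h : X ⟶ Z) : cyl.d₁.app X ≫ cyl.σ.app X ≫ h = h := by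
  rw [reassoc_of% cyl.d₁_app_σ_app X]

theorem d₀_naturality {X Y : C} (f : X ⟶ Y) :
    f ≫ cyl.d₀.app Y = cyl.d₀.app X ≫ cyl.I.map f :=
  cyl.d₀.naturality f

theorem d₀_naturality_assoc {X Y Z : C} (f : X ⟶ Y) (h : cyl.I.obj Y ⟶ Z) :
    f ≫ cyl.d₀.app Y ≫ h = cyl.d₀.app X ≫ cyl.I.map f ≫ h := by
  rw [reassoc_of% cyl.d₀_naturality f]

theorem d₁_naturality {X Y : C} (f : X ⟶ Y) :
    f ≫ cyl.d₁.app Y = cyl.d₁.app X ≫ cyl.I.map f :=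
  cyl.d₁.naturality f

theorem d₁_naturality_assoc {X Y Z : C} (f : X ⟶ Y) (h : cyl.I.obj Y ⟶ Z) :
    f ≫ cyl.d₁.app Y ≫ h = cyl.d₁.app X ≫ cyl.I.map f ≫ h := by
  rw [reassoc_of% cyl.d₁_naturality f]

theorem σ_naturality {X Y : C} (f : X ⟶ Y) :
    cyl.I.map f ≫ cyl.σ.app Y = cyl.σ.app X ≫ f :=
  cyl.σ.naturality f

theorem σ_naturality_assoc {X Y Z : C} (f : X ⟶ Y) (h : Y ⟶ Z) :
    cyl.I.map f ≫ cyl.σ.app Y ≫ h = cyl.σ.app X ≫ f ≫ h := by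
  rw [reassoc_of% cyl.σ_naturality f]

/-- The morphism `X ⊔ X ⟶ I ⊗ X` given by the two endpoints. -/
noncomputable def endpoints [HasBinaryCoproducts C] (X : C) : X ⨿ X ⟶ cyl.I.obj X :=
  coprod.desc (cyl.d₀.app X) (cyl.d₁.app X)

@[simp]
theorem inl_endpoints [HasBinaryCoproducts C] (X : C) :
    coprod.inl ≫ cyl.endpoints X = cyl.d₀.app X :=
  coprod.inl_desc _ _

@[simp]
theorem inl_endpoints_assoc [HasBinaryCoproducts C] {X Z : C} (h : cyl.I.obj X ⟶ Z) :
    coprod.inl ≫ cyl.endpoints X ≫ h = cyl.d₀.app X ≫ h := by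
  rw [reassoc_of% cyl.inl_endpoints X]

@[simp]
theorem inr_endpoints [HasBinaryCoproducts C] (X : C) :
    coprod.inr ≫ cyl.endpoints X = cyl.d₁.app X :=
  coprod.inr_desc _ _

@[simp]
theorem inr_endpoints_assoc [HasBinaryCoproducts C] {X Z : C} (h : cyl.I.obj X ⟶ Z) :
    coprod.inr ≫ cyl.endpoints X ≫ h = cyl.d₁.app X ≫ h := by
  rw [reassoc_of% cyl.inr_endpoints X]

/-- The lifting property of `∂₁ ⊠ i` against `p`, formulated without pushouts. -/
def EndpointLifting {K L E B : C} (i : K ⟶ L) (p : E ⟶ B) : Prop :=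
  ∀ (u : L ⟶ E) (v : cyl.I.obj K ⟶ E) (b : cyl.I.obj L ⟶ B),
    i ≫ u = cyl.d₁.app K ≫ v → u ≫ p = cyl.d₁.app L ≫ b → v ≫ p = cyl.I.map i ≫ b →
    ∃ H : cyl.I.obj L ⟶ E, cyl.d₁.app L ≫ H = u ∧ cyl.I.map i ≫ H = v ∧ H ≫ p = b

/-- The lifting property of `∂I ⊠ i` against `p`, formulated without pushouts. -/
def BoundaryLifting {K L E B : C} (i : K ⟶ L) (p : E ⟶ B) : Prop :=
  ∀ (u₀ u₁ : L ⟶ E) (v : cyl.I.obj K ⟶ E) (b : cyl.I.obj L ⟶ B),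
    i ≫ u₀ = cyl.d₀.app K ≫ v → i ≫ u₁ = cyl.d₁.app K ≫ v →
    u₀ ≫ p = cyl.d₀.app L ≫ b → u₁ ≫ p = cyl.d₁.app L ≫ b → v ≫ p = cyl.I.map i ≫ b →
    ∃ H : cyl.I.obj L ⟶ E, cyl.d₀.app L ≫ H = u₀ ∧ cyl.d₁.app L ≫ H = u₁ ∧
      cyl.I.map i ≫ H = v ∧ H ≫ p = b

/-- A cylinder together with a class `L` of cofibrations for which all objects are cofibrant, and
a class `An` of anodyne extensions, each of them being the left part of a weak factorization
system. -/
structure IsHomotopical [HasInitial C] [HasBinaryCoproducts C] (L An : MorphismProperty C) :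
    Prop where
  isWeakFactorizationSystem : IsWeakFactorizationSystem L L.rlp
  isWeakFactorizationSystem_an : IsWeakFactorizationSystem An An.rlp
  an_le : An ≤ L
  initial_to (X : C) : L (initial.to X)
  nonempty_isInitial : Nonempty (IsInitial (cyl.I.obj (⊥_ C)))
  exists_desc {X Y W : C} (a : cyl.I.obj X ⟶ W) (b : cyl.I.obj Y ⟶ W) :
    ∃ v : cyl.I.obj (X ⨿ Y) ⟶ W, cyl.I.map coprod.inl ≫ v = a ∧ cyl.I.map coprod.inr ≫ v = b
  hom_ext {X Y W : C} {a b : cyl.I.obj (X ⨿ Y) ⟶ W}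
    (h₀ : cyl.I.map coprod.inl ≫ a = cyl.I.map coprod.inl ≫ b)
    (h₁ : cyl.I.map coprod.inr ≫ a = cyl.I.map coprod.inr ≫ b) : a = b
  endpointLifting {K X E B : C} (i : K ⟶ X) (p : E ⟶ B) : L i → An.rlp p →
    cyl.EndpointLifting i p
  boundaryLifting {K X E B : C} (i : K ⟶ X) (p : E ⟶ B) : L i → L.rlp p →
    cyl.BoundaryLifting i p
  boundaryLifting_an {K X E B : C} (i : K ⟶ X) (p : E ⟶ B) : An i → An.rlp p →
    cyl.BoundaryLifting i p

theorem rlp_terminal_of_rlp [HasTerminal C] {An : MorphismProperty C} {X Y : C} {p : X ⟶ Y}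
    (hp : An.rlp p) (hY : An.rlp (terminal.from Y)) : An.rlp (terminal.from X) := by
  rw [← terminal.comp_from p]
  exact comp_mem _ _ _ hp hY

theorem Homotopic.comp_right {cyl : FunctorialCylinder C} {X Y Z : C} {f g : X ⟶ Y}
    (h : cyl.Homotopic f g) (k : Y ⟶ Z) : cyl.Homotopic (f ≫ k) (g ≫ k) := by
  obtain ⟨H, rfl, rfl⟩ := h
  exact ⟨H ≫ k, by simp, by simp⟩

theorem Homotopic.comp_left {cyl : FunctorialCylinder C} {X Y Z : C} {f g : X ⟶ Y}
    (h : cyl.Homotopic f g) (k : Z ⟶ X) : cyl.Homotopic (k ≫ f) (k ≫ g) := by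
  obtain ⟨H, rfl, rfl⟩ := h
  exact ⟨cyl.I.map k ≫ H, by rw [d₀_naturality_assoc], by rw [d₁_naturality_assoc]⟩

theorem Homotopic.refl {X Y : C} (f : X ⟶ Y) : cyl.Homotopic f f :=
  ⟨cyl.σ.app X ≫ f, by simp, by simp⟩

theorem precomp_comp {X Y Z : C} (f : X ⟶ Y) (g : Y ⟶ Z) (W : C) :
    cyl.precomp (f ≫ g) W = cyl.precomp f W ∘ cyl.precomp g W := by
  ext ⟨k⟩
  exact congrArg (Quot.mk _) (Category.assoc _ _ _)

theorem precomp_eq_of_homotopic {X Y : C} {f g : X ⟶ Y} (h : cyl.Homotopic f g) (W : C) :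
    cyl.precomp f W = cyl.precomp g W := by
  ext ⟨k⟩
  exact Quot.sound (h.comp_right k)

theorem precomp_id (X W : C) : cyl.precomp (𝟙 X) W = id := by
  ext ⟨k⟩
  exact congrArg (Quot.mk _) (Category.id_comp _)

section Equivalences

variable [HasTerminal C] (An : MorphismProperty C)

instance : (cyl.equivalences An).HasTwoOutOfThreeProperty where
  comp_mem f g hf hg W hW := by
    rw [precomp_comp]
    exact (hf W hW).comp (hg W hW)
  of_postcomp f g hg hfg W hW := by
    have := hfg W hW
    rw [precomp_comp] at this
    exact (Function.Bijective.of_comp_iff _ (hg W hW)).1 this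
  of_precomp f g hf hfg W hW := by
    have := hfg W hW
    rw [precomp_comp] at this
    exact (Function.Bijective.of_comp_iff' (hf W hW) _).1 this

variable {An}

/-- Part of the two-out-of-six property: precomposition with `g` is injective by the first
hypothesis and surjective by the second. -/
theorem equivalences_of_comp_of_comp {X Y Z T : C} {f : X ⟶ Y} {g : Y ⟶ Z} {h : Z ⟶ T}
    (h₁ : cyl.equivalences An (f ≫ g)) (h₂ : cyl.equivalences An (g ≫ h)) :
    cyl.equivalences An f := by
  have hg : cyl.equivalences An g := fun W hW => by
    have h₁ := h₁ W hW
    have h₂ := h₂ W hW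
    rw [precomp_comp] at h₁ h₂
    exact ⟨h₁.1.of_comp, h₂.2.of_comp⟩
  exact of_postcomp _ f g hg h₁

theorem equivalences_of_homotopic_id {X Y : C} {f : X ⟶ Y} {g : Y ⟶ X}
    (h₁ : cyl.Homotopic (f ≫ g) (𝟙 X)) (h₂ : cyl.Homotopic (g ≫ f) (𝟙 Y)) :
    cyl.equivalences An f := fun W _ => by
  have h₁ := cyl.precomp_eq_of_homotopic h₁ W
  have h₂ := cyl.precomp_eq_of_homotopic h₂ W
  rw [precomp_comp, precomp_id] at h₁ h₂
  exact ⟨Function.LeftInverse.injective (congrFun h₂),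
    Function.RightInverse.surjective (congrFun h₁)⟩

/-- Exchanging the ends reverses the homotopy relation but leaves the generated equivalence relation
unchanged. -/
theorem equivalences_symm : cyl.symm.equivalences An = cyl.equivalences An := by
  have key {X W : C} (f g : X ⟶ W) : cyl.symm.Homotopic f g ↔ cyl.Homotopic g f :=
    ⟨fun ⟨h, h₁, h₂⟩ => ⟨h, h₂, h₁⟩, fun ⟨h, h₁, h₂⟩ => ⟨h, h₂, h₁⟩⟩
  let e (X W : C) : cyl.symm.HomotopyClasses X W ≃ cyl.HomotopyClasses X W :=
    { toFun := Quot.lift (fun f => Quot.mk _ f) fun f g h => (Quot.sound ((key _ _).1 h)).symm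
      invFun := Quot.lift (fun f => Quot.mk _ f) fun f g h => (Quot.sound ((key _ _).2 h)).symm
      left_inv := by rintro ⟨f⟩; rfl
      right_inv := by rintro ⟨f⟩; rfl }
  ext X Y f
  refine forall₂_congr fun W hW => ?_
  have : e X W ∘ cyl.symm.precomp f W = cyl.precomp f W ∘ e Y W := by
    ext ⟨g⟩
    rfl
  rw [← Function.Bijective.of_comp_iff' (e X W).bijective, this,
    Function.Bijective.of_comp_iff _ (e Y W).bijective]

end Equivalences

namespace IsHomotopical

variable {cyl} [HasInitial C] [HasBinaryCoproducts C] {L An : MorphismProperty C}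
  (hA : cyl.IsHomotopical L An)

include hA

theorem exists_factorization {X Y : C} (f : X ⟶ Y) :
    ∃ (Z : C) (i : X ⟶ Z) (p : Z ⟶ Y), L i ∧ L.rlp p ∧ i ≫ p = f := by
  have := hA.isWeakFactorizationSystem
  have h := factorizationData L L.rlp f
  exact ⟨h.Z, h.i, h.p, h.hi, h.hp, h.fac⟩

theorem exists_factorization_an {X Y : C} (f : X ⟶ Y) :
    ∃ (Z : C) (i : X ⟶ Z) (p : Z ⟶ Y), An i ∧ An.rlp p ∧ i ≫ p = f := by
  have := hA.isWeakFactorizationSystem_an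
  have h := factorizationData An An.rlp f
  exact ⟨h.Z, h.i, h.p, h.hi, h.hp, h.fac⟩

theorem llp_rlp : L.rlp.llp = L := hA.isWeakFactorizationSystem.llp

theorem llp_rlp_an : An.rlp.llp = An := hA.isWeakFactorizationSystem_an.llp

/-- The map plays the role of `∂I ⊠ (∅ → X)`, because `I ⊗ ∅` is initial. -/
theorem endpoints_mem (X : C) : L (cyl.endpoints X) := by
  rw [← hA.llp_rlp]
  intro E B p hp
  refine ⟨fun {f g} sq => ?_⟩
  obtain ⟨hI⟩ := hA.nonempty_isInitial
  obtain ⟨H, h₀, h₁, -, h⟩ := hA.boundaryLifting (initial.to X) p (hA.initial_to X) hp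
    (coprod.inl ≫ f) (coprod.inr ≫ f) (hI.to _) g (initial.hom_ext _ _) (initial.hom_ext _ _)
    (by rw [Category.assoc, sq.w, inl_endpoints_assoc])
    (by rw [Category.assoc, sq.w, inr_endpoints_assoc]) (hI.hom_ext _ _)
  exact ⟨⟨H, by apply coprod.hom_ext <;> simp [h₀, h₁], h⟩⟩

/-- The extension of homotopies along three sides of a square. -/
theorem exists_filler {X E B : C} {p : E ⟶ B} (hp : An.rlp p) (h₀ h₁ u : cyl.I.obj X ⟶ E)
    (b : cyl.I.obj (cyl.I.obj X) ⟶ B) (w₀ : cyl.d₁.app X ≫ h₀ = cyl.d₀.app X ≫ u)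
    (w₁ : cyl.d₁.app X ≫ h₁ = cyl.d₁.app X ≫ u) (hu : u ≫ p = cyl.d₁.app _ ≫ b)
    (hb₀ : h₀ ≫ p = cyl.I.map (cyl.d₀.app X) ≫ b) (hb₁ : h₁ ≫ p = cyl.I.map (cyl.d₁.app X) ≫ b) :
    ∃ h : cyl.I.obj X ⟶ E, cyl.d₀.app X ≫ h = cyl.d₀.app X ≫ h₀ ∧
      cyl.d₁.app X ≫ h = cyl.d₀.app X ≫ h₁ ∧ h ≫ p = cyl.d₀.app _ ≫ b := by
  -- The maps `h₀` and `h₁` are glued to a map on `I ⊗ (X ⊔ X)`; with `u` this is a lifting problem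
  -- for `∂₁ ⊠ (X ⊔ X → I ⊗ X)`. The fourth side of the solution is the result.
  obtain ⟨v, hv₀, hv₁⟩ := hA.exists_desc h₀ h₁
  obtain ⟨d, e₀, e₁, hd⟩ : ∃ d : X ⨿ X ⟶ cyl.I.obj X, coprod.inl ≫ d = cyl.d₀.app X ∧
    coprod.inr ≫ d = cyl.d₁.app X ∧ L d := ⟨_, by simp, by simp, hA.endpoints_mem X⟩
  have eI₀ := congrArg cyl.I.map e₀
  have eI₁ := congrArg cyl.I.map e₁
  simp only [Functor.map_comp] at eI₀ eI₁
  obtain ⟨H, h, h', hb⟩ := hA.endpointLifting d p hd hp u v b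
    (by
      apply coprod.hom_ext
      · rw [reassoc_of% e₀, d₁_naturality_assoc, hv₀, w₀]
      · rw [reassoc_of% e₁, d₁_naturality_assoc, hv₁, w₁]) hu
    (by
      apply hA.hom_ext
      · rw [reassoc_of% hv₀, hb₀, reassoc_of% eI₀]
      · rw [reassoc_of% hv₁, hb₁, reassoc_of% eI₁])
  refine ⟨cyl.d₀.app _ ≫ H, ?_, ?_, by rw [Category.assoc, hb]⟩
  · have := cyl.d₀_naturality (cyl.d₀.app X)
    rw [← hv₀, ← h', reassoc_of% eI₀, reassoc_of% this]
  · have := cyl.d₀_naturality (cyl.d₁.app X)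
    rw [← hv₁, ← h', reassoc_of% eI₁, reassoc_of% this]

variable [HasTerminal C]

/-- With constant homotopies for some of the sides, this one statement gives both symmetry and
transitivity. -/
theorem fill {X W : C} (hW : An.rlp (terminal.from W)) {a b a' b' : X ⟶ W}
    (h₀ : cyl.Homotopic a b) (h₁ : cyl.Homotopic a' b') (u : cyl.Homotopic b b') :
    cyl.Homotopic a a' := by
  obtain ⟨h₀, rfl, rfl⟩ := h₀
  obtain ⟨h₁, rfl, rfl⟩ := h₁
  obtain ⟨u, w₀, w₁⟩ := u
  obtain ⟨h, e₀, e₁, -⟩ := hA.exists_filler hW h₀ h₁ u (terminal.from _) w₀.symm w₁.symm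
    (terminal.hom_ext _ _) (terminal.hom_ext _ _) (terminal.hom_ext _ _)
  exact ⟨h, e₀, e₁⟩

theorem equivalence_homotopic (X : C) {W : C} (hW : An.rlp (terminal.from W)) :
    Equivalence (cyl.Homotopic (X := X) (Y := W)) where
  refl f := .refl _ f
  symm h := hA.fill hW (.refl _ _) h (.refl _ _)
  trans h h' := hA.fill hW h (.refl _ _) h'

theorem equivalences_iff {X Y : C} (f : X ⟶ Y) :
    cyl.equivalences An f ↔ ∀ W : C, An.rlp (terminal.from W) →
      (∀ g g' : Y ⟶ W, cyl.Homotopic (f ≫ g) (f ≫ g') → cyl.Homotopic g g') ∧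
      ∀ g : X ⟶ W, ∃ g', cyl.Homotopic (f ≫ g') g := by
  refine forall₂_congr fun W hW => and_congr ?_ ?_
  · have hX (Z : C) (g g' : Z ⟶ W) : (Quot.mk _ g : cyl.HomotopyClasses Z W) = Quot.mk _ g' ↔
        cyl.Homotopic g g' := by
      rw [Quot.eq, (hA.equivalence_homotopic Z hW).eqvGen_iff]
    refine ⟨fun h g g' w => (hX _ _ _).1 (h (a₁ := Quot.mk _ g) (a₂ := Quot.mk _ g')
      ((hX _ _ _).2 w)), ?_⟩
    rintro h ⟨g⟩ ⟨g'⟩ w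
    exact (hX _ _ _).2 (h _ _ ((hX _ _ _).1 w))
  · have hX (Z : C) (g g' : Z ⟶ W) : (Quot.mk _ g : cyl.HomotopyClasses Z W) = Quot.mk _ g' ↔
        cyl.Homotopic g g' := by
      rw [Quot.eq, (hA.equivalence_homotopic Z hW).eqvGen_iff]
    constructor
    · intro h g
      obtain ⟨⟨g'⟩, w⟩ := h (Quot.mk _ g)
      exact ⟨g', (hX _ _ _).1 w⟩
    · rintro h ⟨g⟩
      obtain ⟨g', w⟩ := h g
      exact ⟨Quot.mk _ g', (hX _ _ _).2 w⟩

/-- Such a map `p` has a section `s`, and lifting against the endpoint inclusion gives a homotopy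
from `p ≫ s` to the identity. -/
theorem rlp_le_equivalences : L.rlp ≤ cyl.equivalences An := fun X Y p hp => by
  obtain ⟨s, -, hs⟩ := exists_lift (hp _ (hA.initial_to Y)) (a := initial.to X) (b := 𝟙 Y)
    (initial.hom_ext _ _)
  obtain ⟨h, h₁, -⟩ := exists_lift (hp _ (hA.endpoints_mem X)) (a := coprod.desc (p ≫ s) (𝟙 X))
    (b := cyl.σ.app X ≫ p) (by
      apply coprod.hom_ext <;>
        simp [hs, coprod.inl_desc, coprod.inr_desc])
  refine equivalences_of_homotopic_id (g := s) _ ⟨h, ?_, ?_⟩ (by rw [hs]; exact .refl _ _)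
  · simpa [coprod.inl_desc] using congrArg (coprod.inl ≫ ·) h₁
  · simpa [coprod.inr_desc] using congrArg (coprod.inr ≫ ·) h₁

/-- Lifting against `i` gives surjectivity on homotopy classes; lifting against `∂I ⊠ i` gives
injectivity. -/
theorem le_equivalences : An ≤ cyl.equivalences An := fun X Y i hi => by
  rw [hA.equivalences_iff]
  refine fun W hW => ⟨?_, fun g => ?_⟩
  · rintro g g' ⟨v, h₀, h₁⟩
    obtain ⟨H, h₀, h₁, -⟩ := hA.boundaryLifting_an i _ hi hW g g' v (terminal.from _) h₀.symm
      h₁.symm (terminal.hom_ext _ _) (terminal.hom_ext _ _) (terminal.hom_ext _ _)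
    exact ⟨H, h₀, h₁⟩
  · obtain ⟨l, hl, -⟩ := exists_lift (hW i hi) (a := g) (b := terminal.from _)
      (terminal.hom_ext _ _)
    exact ⟨l, by rw [hl]; exact .refl _ _⟩

/-- A homotopy inverse of `p` is improved to a strict section `s`, and the homotopy from the
identity to `p ≫ s` to one that is constant over `Y`. A lifting problem is then solved up to this
homotopy by means of `s`, and the solution is corrected by lifting against `∂₁ ⊠ i`. -/
theorem rlp_of_equivalences {X Y : C} {p : X ⟶ Y} (hp : An.rlp p)
    (hY : An.rlp (terminal.from Y)) (hw : cyl.equivalences An p) : L.rlp p := by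
  have hX := rlp_terminal_of_rlp hp hY
  have hw := hA.equivalences_iff p |>.1 hw
  obtain ⟨s', hs'⟩ := (hw X hX).2 (𝟙 X)
  have hs'' : cyl.Homotopic (𝟙 Y) (s' ≫ p) := (hw Y hY).1 _ _ (by
    simpa using ((hA.equivalence_homotopic X hX).symm hs').comp_right p)
  obtain ⟨h, h₀, h₁⟩ := hs''
  obtain ⟨hI⟩ := hA.nonempty_isInitial
  -- The homotopy `h` from the identity to `s' ≫ p` is lifted starting from `s'` at the end `1`; its
  -- end `0` is a strict section.
  obtain ⟨H, e₁, -, e⟩ := hA.endpointLifting (initial.to Y) p (hA.initial_to Y) hp s' (hI.to X) h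
    (initial.hom_ext _ _) h₁.symm (hI.hom_ext _ _)
  obtain ⟨s, hs⟩ : ∃ s : Y ⟶ X, cyl.d₀.app Y ≫ H = s := ⟨_, rfl⟩
  have hsp : s ≫ p = 𝟙 Y := by rw [← hs, Category.assoc, e, h₀]
  have hps : cyl.Homotopic (𝟙 X) (p ≫ s) := by
    have hE := hA.equivalence_homotopic X hX
    exact hE.trans (hE.symm hs') (hE.symm (Homotopic.comp_left ⟨H, hs, e₁⟩ p))
  obtain ⟨k, k₀, k₁⟩ := hps
  have k₁' := congrArg (· ≫ p ≫ s) k₁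
  simp only [Category.assoc, reassoc_of% hsp] at k₁'
  -- Both `k` and `k ≫ p ≫ s` lie over `k ≫ p`, so joining the first to the reverse of the second
  -- can be done over the constant homotopy at `p`.
  obtain ⟨k', k'₀, k'₁, k'p⟩ := hA.exists_filler hp k (k ≫ p ≫ s) (cyl.σ.app X ≫ p ≫ s)
    (cyl.I.map (cyl.σ.app X) ≫ k ≫ p) (by simp [k₁]) (by simp [k₁'])
    (by
      have := cyl.d₁_naturality (cyl.σ.app X)
      dsimp at this
      rw [← reassoc_of% this, reassoc_of% k₁, Category.assoc, Category.assoc])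
    (by rw [← Functor.map_comp_assoc, d₀_app_σ_app]; simp)
    (by rw [← Functor.map_comp_assoc, d₁_app_σ_app]; simp [hsp])
  have k'₂ : k' ≫ p = cyl.σ.app X ≫ p := by
    have := cyl.d₀_naturality (cyl.σ.app X)
    dsimp at this
    rw [k'p, ← reassoc_of% this, reassoc_of% k₀]
  rw [k₀] at k'₀
  rw [reassoc_of% k₀] at k'₁
  intro K M i hi
  refine ⟨fun {a b} sq => ?_⟩
  -- At the end `1` the approximate solution `b ≫ s` is prescribed, on `I ⊗ K` the homotopy `k'`
  -- along `a`; the end `0` is the exact solution.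
  obtain ⟨H, -, hH, hHp⟩ := hA.endpointLifting i p hi hp (b ≫ s) (cyl.I.map a ≫ k')
    (cyl.σ.app M ≫ b)
    (by
      have := cyl.d₁_naturality a
      rw [← reassoc_of% this, k'₁, reassoc_of% sq.w])
    (by simp [hsp])
    (by rw [Category.assoc, k'₂, σ_naturality_assoc, σ_naturality_assoc, sq.w])
  exact ⟨⟨cyl.d₀.app M ≫ H, by
    have := cyl.d₀_naturality a
    rw [d₀_naturality_assoc, hH, ← reassoc_of% this, k'₀, Category.comp_id],
    by rw [Category.assoc, hHp, d₀_app_σ_app_assoc]⟩⟩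

/-- Here `j` is a fibrant replacement of `Y` and `i ≫ j` is factored as an anodyne `k` and a
fibration `q`. If `i` is a weak equivalence then so is `q`, hence `q` lifts against `L`, and lifting
problems for `i` reduce to ones for `j` and `k`. Conversely, a lift `l` of `i` against `q` satisfies
`i ≫ l = k` and `l ≫ q = j`, and two-out-of-six applies. -/
theorem equivalences_iff_hasLiftingProperty {X Y : C} (i : X ⟶ Y) (hi : L i) :
    cyl.equivalences An i ↔ ∀ ⦃E B : C⦄ (p : E ⟶ B), An.rlp p → An.rlp (terminal.from B) →
      HasLiftingProperty i p := by
  obtain ⟨Y', j, p, hj, hY', -⟩ := hA.exists_factorization_an (terminal.from Y)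
  obtain rfl := Subsingleton.elim p (terminal.from Y')
  obtain ⟨X', k, q, hk, hq, fac⟩ := hA.exists_factorization_an (i ≫ j)
  have hj' := hA.le_equivalences _ hj
  have hk' := hA.le_equivalences _ hk
  constructor
  · refine fun hw E B p hp hB => ⟨fun {a b} sq => ?_⟩
    have hq' := hA.rlp_of_equivalences hq hY'
      (of_precomp _ _ _ hk' (by rw [fac]; exact comp_mem _ _ _ hw hj'))
    obtain ⟨l, hl, hl'⟩ := exists_lift (hq' i hi) fac
    obtain ⟨b', hb', -⟩ := exists_lift (hB j hj) (a := b) (b := terminal.from _)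
      (terminal.hom_ext _ _)
    obtain ⟨a', ha', ha''⟩ := exists_lift (hp k hk) (a := a) (b := q ≫ b')
      (by rw [reassoc_of% fac, hb', sq.w])
    exact ⟨⟨l ≫ a', by rw [reassoc_of% hl, ha'],
      by rw [Category.assoc, ha'', reassoc_of% hl', hb']⟩⟩
  · intro h
    obtain ⟨l, hl, hl'⟩ := exists_lift (h q hq hY') fac
    exact cyl.equivalences_of_comp_of_comp (g := l) (h := q) (by rwa [hl]) (by rwa [hl'])

end IsHomotopical

end FunctorialCylinder

end Cisinski

/-! ### Local presentability from detecting families. -/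

section Detecting

variable {C : Type u} [Category.{w} C]

theorem isStrongGenerator_of_isDetecting [HasEqualizers C] {P : ObjectProperty C}
    (hP : P.IsDetecting) : P.IsStrongGenerator := by
  rw [ObjectProperty.isStrongGenerator_iff]
  refine ⟨hP.isSeparating, fun X Y i _ h => hP _ fun G hG g => ?_⟩
  obtain ⟨g', hg'⟩ := h G hG g
  exact ⟨g', hg', fun g'' h => (cancel_mono i).1 (h.trans hg'.symm)⟩

theorem isDetecting_of_isStrongGenerator {P : ObjectProperty C} (hP : P.IsStrongGenerator) :
    P.IsDetecting := fun X Y f hf => by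
  have : Mono f := ⟨fun u v huv => hP.isSeparating _ _ fun G hG g =>
    (hf G hG (g ≫ v ≫ f)).unique (by simp [huv]) (by simp)⟩
  exact hP.isIso_of_mono f fun G hG g => (hf G hG g).exists

variable (κ : Cardinal.{w}) [Fact κ.IsRegular]

theorem isCardinalLocallyPresentable_of_isDetecting [HasColimitsOfSize.{w, w} C] [HasEqualizers C]
    {ι : Type w} (G : ι → C) [∀ i, IsCardinalPresentable (G i) κ]
    (hG : (ObjectProperty.ofObj G).IsDetecting) : IsCardinalLocallyPresentable C κ := by
  rw [IsCardinalLocallyPresentable.iff_exists_isStrongGenerator]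
  refine ⟨_, inferInstance, isStrongGenerator_of_isDetecting hG, ?_⟩
  rintro _ ⟨i⟩
  rw [isCardinalPresentable_iff]
  infer_instance

theorem exists_isDetecting (C : Type u) [Category.{w} C] [IsCardinalLocallyPresentable C κ] :
    ∃ (ι : Type w) (G : ι → C), (∀ i, IsCardinalPresentable (G i) κ) ∧
      (ObjectProperty.ofObj G).IsDetecting := by
  obtain ⟨P, _, hP, hP'⟩ :=
    (IsCardinalLocallyPresentable.iff_exists_isStrongGenerator C κ).1 inferInstance
  refine ⟨Shrink.{w} (Subtype P), fun i => ((equivShrink _).symm i).1, fun i => ?_, ?_⟩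
  · simpa [isCardinalPresentable_iff] using hP' _ ((equivShrink (Subtype P)).symm i).2
  · refine (isDetecting_of_isStrongGenerator hP).of_le fun X hX => ?_
    exact (ObjectProperty.ofObj_iff _ _).2 ⟨equivShrink (Subtype P) ⟨X, hX⟩, by simp⟩

end Detecting

/-! ### Local presentability of the arrow category. -/

section Arrow

variable {C : Type u} [Category.{w} C]

/-- The functor sending an object to its identity is left adjoint to the source functor. -/
def idArrowAdjunction : ({ obj X := Arrow.mk (𝟙 X), map f := Arrow.homMk f f } : C ⥤ Arrow C) ⊣
    Arrow.leftFunc :=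
  Adjunction.mkOfHomEquiv
    { homEquiv X w :=
        { toFun f := f.left
          invFun g := Arrow.homMk g (g ≫ w.hom)
          left_inv f := by
            have := Arrow.w f
            dsimp at this
            rw [Category.id_comp] at this
            ext
            · rfl
            · exact this
          right_inv g := rfl }
      homEquiv_naturality_left_symm f g := by
        ext
        · rfl
        · exact Category.assoc _ _ _
      homEquiv_naturality_right _ _ := rfl }

/-- The functor sending an object to the arrow from the initial object is left adjoint to the
target functor. -/
noncomputable def initialArrowAdjunction [HasInitial C] :
    ({ obj X := Arrow.mk (initial.to X), map f := Arrow.homMk (𝟙 _) f } : C ⥤ Arrow C) ⊣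
    Arrow.rightFunc :=
  Adjunction.mkOfHomEquiv
    { homEquiv X w :=
        { toFun f := f.right
          invFun g := Arrow.homMk (initial.to _) g
          left_inv f := by
            ext
            · exact initial.hom_ext _ _
            · rfl
          right_inv g := rfl }
      homEquiv_naturality_left_symm f g := by
        ext
        · exact initial.hom_ext _ _
        · rfl
      homEquiv_naturality_right _ _ := rfl }

variable (κ : Cardinal.{w}) [Fact κ.IsRegular]

instance [HasColimitsOfSize.{w, w} C] (X : C) [IsCardinalPresentable X κ] :
    IsCardinalPresentable (Arrow.mk (𝟙 X)) κ :=
  have : PreservesColimitsOfSize.{w, w} (Arrow.leftFunc (C := C)) := ⟨inferInstance⟩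
  idArrowAdjunction.isCardinalPresentable_leftAdjoint_obj κ X

theorem isCardinalPresentable_initialArrow [HasColimitsOfSize.{w, w} C] (X : C)
    [IsCardinalPresentable X κ] :
    IsCardinalPresentable (Arrow.mk (initial.to X)) κ :=
  have : PreservesColimitsOfSize.{w, w} (Arrow.rightFunc (C := C)) := ⟨inferInstance⟩
  initialArrowAdjunction.isCardinalPresentable_leftAdjoint_obj κ X

/-- Maps out of `𝟙 G` see the source of an arrow and maps out of `∅ → G` see its target, so together
they detect isomorphisms of arrows. -/
instance [IsCardinalLocallyPresentable C κ] [HasFiniteLimits C] :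
    IsCardinalLocallyPresentable (Arrow C) κ := by
  obtain ⟨ι, G, _, h⟩ := exists_isDetecting κ C
  let G' : ι ⊕ ι → Arrow C := Sum.elim (fun i => Arrow.mk (𝟙 (G i)))
    (fun i => Arrow.mk (initial.to (G i)))
  have (i : ι ⊕ ι) : IsCardinalPresentable (G' i) κ := by
    rcases i with i | i
    · exact inferInstanceAs (IsCardinalPresentable (Arrow.mk (𝟙 (G i))) κ)
    · exact isCardinalPresentable_initialArrow κ (G i)
  have : HasColimitsOfSize.{w, w} (Arrow C) := ⟨inferInstance⟩
  have : HasEqualizers (Arrow C) := inferInstance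
  refine isCardinalLocallyPresentable_of_isDetecting κ G' fun X Y f hf => ?_
  have h₁ : IsIso f.left := h _ <| by
    rintro _ ⟨i⟩ g
    obtain ⟨g', hg', hg''⟩ := hf _ ⟨Sum.inl i⟩ (Arrow.homMk g (g ≫ Y.hom) : Arrow.mk (𝟙 (G i)) ⟶ Y)
    refine ⟨g'.left, congrArg CommaMorphism.left hg', fun k hk => ?_⟩
    refine congrArg CommaMorphism.left (hg'' (Arrow.homMk k (k ≫ X.hom)) ?_)
    ext
    · exact hk
    · have := Arrow.w f
      dsimp at hk this
      have key : (k ≫ X.hom) ≫ f.right = g ≫ Y.hom := by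
        rw [Category.assoc, ← this, reassoc_of% hk]
      exact key
  have h₂ : IsIso f.right := h _ <| by
    rintro _ ⟨i⟩ g
    obtain ⟨g', hg', hg''⟩ := hf _ ⟨Sum.inr i⟩
      (Arrow.homMk (initial.to _) g : Arrow.mk (initial.to (G i)) ⟶ Y)
    refine ⟨g'.right, congrArg CommaMorphism.right hg', fun k hk => ?_⟩
    refine congrArg CommaMorphism.right (hg'' (Arrow.homMk (initial.to _) k) ?_)
    ext
    · exact initial.hom_ext _ _
    · exact hk
  exact Arrow.isIso_of_isIso_left_of_isIso_right f

instance [IsLocallyPresentable.{w} C] [HasFiniteLimits C] : IsLocallyPresentable.{w} (Arrow C) := by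
  obtain ⟨κ, _, _⟩ := IsLocallyPresentable.exists_cardinal.{w} C
  exact ⟨κ, inferInstance, inferInstance⟩

end Arrow

/-! ### A small set generating the trivial cofibrations. -/

section SmallGenerators

variable {C : Type u} [Category.{w} C] [HasFiniteLimits C] [HasColimitsOfSize.{w, w} C]

/-- The morphisms of arrows such that an arrow is injective with respect to them if and only if it
has the right lifting property with respect to `l` and its target is injective with respect to
`l`. -/
noncomputable def arrowCell {K : Type w} {a b : K → C} (l : ∀ k, a k ⟶ b k) :
    ∀ k : K ⊕ K, (Sum.elim (fun k => Arrow.mk (l k)) (fun k => Arrow.mk (initial.to (a k))) k :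
      Arrow C) ⟶ Sum.elim (fun k => Arrow.mk (𝟙 (b k))) (fun k => Arrow.mk (initial.to (b k))) k
  | .inl k => Arrow.homMk (l k) (𝟙 _)
  | .inr k => Arrow.homMk (𝟙 _) (l k)

/-- This is the injective replacement for `arrowCell l`. The two components of `η` are tested
against a map `q` by transposing along the right adjoints `E ↦ (E → ⊤)` and `E ↦ 𝟙 E` of the source
and target functors. -/
theorem exists_arrowReplacement {K : Type w} {a b : K → C} (l : ∀ k, a k ⟶ b k) (κ : Cardinal.{w})
    [Fact κ.IsRegular]
    [∀ k, IsCardinalPresentable (Arrow.mk (l k)) κ]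
    [∀ k, IsCardinalPresentable (Arrow.mk (initial.to (a k))) κ] :
    ∃ (R : Arrow C ⥤ Arrow C) (η : 𝟭 (Arrow C) ⟶ R), R.IsCardinalAccessible κ ∧
      (∀ X, (MorphismProperty.ofHoms l).rlp.llp (η.app X).left) ∧
      (∀ X, (MorphismProperty.ofHoms l).rlp.llp (η.app X).right) ∧
      (∀ X : Arrow C, (MorphismProperty.ofHoms l).rlp (R.obj X).hom) ∧
      ∀ X : Arrow C, (MorphismProperty.ofHoms l).rlp (terminal.from (R.obj X).right) := by
  have (k : K ⊕ K) : IsCardinalPresentable (Sum.elim (fun k => Arrow.mk (l k))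
      (fun k => Arrow.mk (initial.to (a k))) k : Arrow C) κ := by
    rcases k with k | k
    · exact inferInstanceAs (IsCardinalPresentable (Arrow.mk (l k)) κ)
    · exact inferInstanceAs (IsCardinalPresentable (Arrow.mk (initial.to (a k))) κ)
  obtain ⟨R, η, hR, h₁, h₂⟩ := exists_injectiveReplacement (arrowCell l) κ
  refine ⟨R, η, hR, fun X E B q hq => ?_, fun X E B q hq => ?_, fun W => ?_, fun W => ?_⟩
  · have hT : (MorphismProperty.ofHoms (arrowCell l)).rlp (Arrow.homMk q (𝟙 _) (by simp) :
        Arrow.mk (terminal.from E) ⟶ Arrow.mk (terminal.from B)) := by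
      rintro _ _ _ ⟨k | k⟩
      · refine ⟨fun {u v} sq => ?_⟩
        obtain ⟨m, hm, hm'⟩ := exists_lift (hq _ ⟨k⟩) (congrArg CommaMorphism.left sq.w)
        exact ⟨⟨Arrow.homMk m (terminal.from _) (terminal.hom_ext _ _),
          Arrow.hom_ext _ _ hm (terminal.hom_ext _ _),
          Arrow.hom_ext _ _ hm' (terminal.hom_ext _ _)⟩⟩
      · refine ⟨fun {u v} sq => ?_⟩
        exact ⟨⟨Arrow.homMk (initial.to _) (terminal.from _) (terminal.hom_ext _ _),
          Arrow.hom_ext _ _ (initial.hom_ext _ _) (terminal.hom_ext _ _),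
          Arrow.hom_ext _ _ (initial.hom_ext _ _) (terminal.hom_ext _ _)⟩⟩
    refine ⟨fun {u v} sq => ?_⟩
    obtain ⟨m, hm, hm'⟩ := exists_lift (h₁ X _ hT)
      (a := (Arrow.homMk u (terminal.from _) (terminal.hom_ext _ _) :
        X ⟶ Arrow.mk (terminal.from E)))
      (b := (Arrow.homMk v (terminal.from _) (terminal.hom_ext _ _)))
      (Arrow.hom_ext _ _ sq.w (terminal.hom_ext _ _))
    exact ⟨⟨m.left, congrArg CommaMorphism.left hm, congrArg CommaMorphism.left hm'⟩⟩
  · have hT : (MorphismProperty.ofHoms (arrowCell l)).rlp (Arrow.homMk q q (by simp) :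
        Arrow.mk (𝟙 E) ⟶ Arrow.mk (𝟙 B)) := by
      rintro _ _ _ ⟨k | k⟩
      · refine ⟨fun {u v} sq => ?_⟩
        have hu : u.left ≫ 𝟙 E = l k ≫ u.right := u.w
        have hv : v.left ≫ 𝟙 B = 𝟙 (b k) ≫ v.right := v.w
        have w : u.right ≫ q = 𝟙 (b k) ≫ v.right := congrArg CommaMorphism.right sq.w
        let m : b k ⟶ E := u.right
        exact ⟨⟨Arrow.homMk m m ((Category.comp_id _).trans (Category.id_comp _).symm),
          Arrow.hom_ext _ _ (hu.symm.trans (Category.comp_id _)) (Category.id_comp _),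
          Arrow.hom_ext _ _ (w.trans (hv.symm.trans (Category.comp_id _)))
            (w.trans (Category.id_comp _))⟩⟩
      · refine ⟨fun {u v} sq => ?_⟩
        obtain ⟨m, hm, hm'⟩ := exists_lift (hq _ ⟨k⟩) (congrArg CommaMorphism.right sq.w)
        exact ⟨⟨Arrow.homMk (initial.to _) m (initial.hom_ext _ _),
          Arrow.hom_ext _ _ (initial.hom_ext _ _) hm,
          Arrow.hom_ext _ _ (initial.hom_ext _ _) hm'⟩⟩
    refine ⟨fun {u v} sq => ?_⟩
    have hη : (η.app X).left ≫ (R.obj X).hom = X.hom ≫ (η.app X).right := (η.app X).w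
    have w : (X.hom ≫ u) ≫ q = (η.app X).left ≫ (R.obj X).hom ≫ v := by
      rw [reassoc_of% hη, Category.assoc, sq.w]
    obtain ⟨m, hm, hm'⟩ := exists_lift (h₁ X _ hT)
      (a := (Arrow.homMk (X.hom ≫ u) u (Category.comp_id _) : X ⟶ Arrow.mk (𝟙 E)))
      (b := (Arrow.homMk ((R.obj X).hom ≫ v) v (Category.comp_id _)))
      (Arrow.hom_ext _ _ w sq.w)
    exact ⟨⟨m.right, congrArg CommaMorphism.right hm, congrArg CommaMorphism.right hm'⟩⟩
  · rintro _ _ _ ⟨k⟩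
    refine ⟨fun {u v} sq => ?_⟩
    obtain ⟨g, hg⟩ := h₂ W (.inl k) (Arrow.homMk u v sq.w)
    have hg' : g.left ≫ (R.obj W).hom = 𝟙 (b k) ≫ g.right := g.w
    have hr : 𝟙 (b k) ≫ g.right = v := congrArg CommaMorphism.right hg
    exact ⟨⟨g.left, congrArg CommaMorphism.left hg, hg'.trans hr⟩⟩
  · rintro _ _ _ ⟨k⟩
    refine ⟨fun {u v} sq => ?_⟩
    obtain ⟨g, hg⟩ := h₂ W (.inr k) (Arrow.homMk (initial.to _) u (initial.hom_ext _ _))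
    exact ⟨⟨g.right, congrArg CommaMorphism.right hg, terminal.hom_ext _ _⟩⟩

variable [HasTerminal C] {cyl : FunctorialCylinder C} {L An : MorphismProperty C}

/-- This supplies the solution set condition of Smith's theorem: a square from a generator `i k` to
a weak equivalence factors through one of a small family of weak equivalences `W ω`, and then
through a trivial cofibration built from that square. -/
theorem FunctorialCylinder.IsHomotopical.exists_small_generators [IsLocallyPresentable.{w} C]
    (hA : cyl.IsHomotopical L An) (M S : MorphismProperty C)
    [MorphismProperty.IsSmall.{w} M] [MorphismProperty.IsSmall.{w} S] (hM : M.rlp = L.rlp)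
    (hS : S.rlp = An.rlp) :
    ∃ J : MorphismProperty C, MorphismProperty.IsSmall.{w} J ∧ J ≤ L ⊓ cyl.equivalences An ∧
      J.rlp ⊓ cyl.equivalences An ≤ L.rlp := by
  obtain ⟨G, s, t, i, rfl⟩ := (MorphismProperty.isSmall_iff_eq_ofHoms.{w} M).1 inferInstance
  obtain ⟨K, a, b, l, rfl⟩ := (MorphismProperty.isSmall_iff_eq_ofHoms.{w} S).1 inferInstance
  let O : K ⊕ K ⊕ G ⊕ G → Arrow C := Sum.elim (fun k => Arrow.mk (l k))
    (Sum.elim (fun k => Arrow.mk (initial.to (a k)))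
      (Sum.elim (fun k => Arrow.mk (i k)) (fun k => Arrow.mk (𝟙 (t k)))))
  obtain ⟨κ, _, -, _, hO⟩ := exists_isRegular_and_isCardinalPresentable (Arrow C) O 0
  have (k : K) : IsCardinalPresentable (Arrow.mk (l k)) κ := hO (.inl k)
  have (k : K) : IsCardinalPresentable (Arrow.mk (initial.to (a k))) κ := hO (.inr (.inl k))
  have (k : G) : IsCardinalPresentable (Arrow.mk (i k)) κ := hO (.inr (.inr (.inl k)))
  have (k : G) : IsCardinalPresentable (Arrow.mk (𝟙 (t k))) κ := hO (.inr (.inr (.inr k)))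
  obtain ⟨R, η, _, h₁, h₂, h₃, h₄⟩ := exists_arrowReplacement l κ
  rw [hS, hA.llp_rlp_an] at h₁ h₂
  rw [hS] at h₃ h₄
  -- Between `W` and its replacement two-out-of-three applies; for the replacement, being a weak
  -- equivalence means lifting against the generators `i k`, which is injectivity in the arrow
  -- category with respect to the squares `i k → 𝟙 (t k)`.
  have key (W : Arrow C) : cyl.equivalences An W.hom ↔
      ∀ k (g : Arrow.mk (i k) ⟶ R.obj W), ∃ g' : Arrow.mk (𝟙 (t k)) ⟶ R.obj W,
        (Arrow.homMk (i k) (𝟙 _) : Arrow.mk (i k) ⟶ Arrow.mk (𝟙 (t k))) ≫ g' = g := by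
    have h₁ := hA.le_equivalences _ (h₁ W)
    have h₂ := hA.le_equivalences _ (h₂ W)
    have h : cyl.equivalences An W.hom ↔ cyl.equivalences An (R.obj W).hom := by
      have w : (η.app W).left ≫ (R.obj W).hom = W.hom ≫ (η.app W).right := (η.app W).w
      constructor
      · intro h
        exact MorphismProperty.of_precomp _ _ _ h₁ (w ▸ MorphismProperty.comp_mem _ _ _ h h₂)
      · intro h
        exact MorphismProperty.of_postcomp _ _ _ h₂ (w ▸ MorphismProperty.comp_mem _ _ _ h₁ h)
    have h' : cyl.equivalences An (R.obj W).hom ↔ L.rlp (R.obj W).hom :=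
      ⟨hA.rlp_of_equivalences (h₃ W) (h₄ W), fun h => hA.rlp_le_equivalences _ h⟩
    rw [h, h', ← hM]
    constructor
    · intro h k g
      obtain ⟨m, hm, hm'⟩ := exists_lift (h _ ⟨k⟩) g.w
      exact ⟨Arrow.homMk m g.right (hm'.trans (Category.id_comp _).symm),
        Arrow.hom_ext _ _ hm (Category.id_comp _)⟩
    · rintro h _ _ _ ⟨k⟩
      refine ⟨fun {u v} sq => ?_⟩
      obtain ⟨g, hg⟩ := h k (Arrow.homMk u v sq.w)
      have hg' : g.left ≫ (R.obj W).hom = 𝟙 (t k) ≫ g.right := g.w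
      have hr : 𝟙 (t k) ≫ g.right = v := congrArg CommaMorphism.right hg
      exact ⟨⟨g.left, congrArg CommaMorphism.left hg, hg'.trans hr⟩⟩
  obtain ⟨Ω, W, hW, hΩ⟩ := exists_solutionSet (κ := κ)
    (fun k => (Arrow.homMk (i k) (𝟙 _) : Arrow.mk (i k) ⟶ Arrow.mk (𝟙 (t k)))) R
    (fun k => Arrow.mk (i k))
  have hW' (ω : Ω) : cyl.equivalences An (W ω).hom := (key _).2 (hW ω)
  have := hA.isWeakFactorizationSystem
  have : L.IsStableUnderCobaseChange := by rw [← hA.llp_rlp]; infer_instance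
  have : L.IsStableUnderComposition := by rw [← hA.llp_rlp]; infer_instance
  let N := Σ (k : G) (ω : Ω), (Arrow.mk (i k) ⟶ W ω)
  have hN (n : N) : ∃ (Z : C) (j : (W n.2.1).left ⟶ Z) (p : Z ⟶ (W n.2.1).right) (m : t n.1 ⟶ Z),
      L j ∧ cyl.equivalences An j ∧ j ≫ p = (W n.2.1).hom ∧ n.2.2.left ≫ j = i n.1 ≫ m ∧
      m ≫ p = n.2.2.right := by
    obtain ⟨k, ω, x⟩ := n
    have hx : x.left ≫ (W ω).hom = i k ≫ x.right := x.w
    have hL : (MorphismProperty.ofHoms i) ≤ L := by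
      rw [← hA.llp_rlp, ← hM]
      exact MorphismProperty.le_llp_rlp _
    -- The pushout of `i k` along `x.left` maps to the target of `W ω`. Factoring this map turns the
    -- cobase change of `i k` into a cofibration into `Z`, which is a weak equivalence by
    -- two-out-of-three.
    obtain ⟨Z, j, p, hj, hp, fac⟩ := hA.exists_factorization (pushout.desc (W ω).hom x.right hx)
    refine ⟨Z, pushout.inl _ _ ≫ j, p, pushout.inr _ _ ≫ j, ?_, ?_, by simp [fac, pushout.inl_desc],
      by rw [pushout.condition_assoc], by simp [fac, pushout.inr_desc]⟩
    · refine MorphismProperty.comp_mem _ _ _ ?_ hj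
      exact MorphismProperty.pushout_inl _ _ (hL _ ⟨k⟩)
    · refine MorphismProperty.of_postcomp _ _ _ (hA.rlp_le_equivalences _ hp) ?_
      simpa [fac, pushout.inl_desc] using hW' ω
  choose Z j p m hj hj' hjp hm hmp using hN
  refine ⟨.ofHoms j, inferInstance, ?_, ?_⟩
  · rintro _ _ _ ⟨n⟩
    exact ⟨hj n, hj' n⟩
  · rintro E B q ⟨hq, hq'⟩
    rw [← hM]
    rintro _ _ _ ⟨k⟩
    refine ⟨fun {u v} sq => ?_⟩
    obtain ⟨ω, x, y, hxy⟩ := hΩ (Arrow.mk q) ((key _).1 hq') k (Arrow.homMk u v sq.w)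
    have hl : x.left ≫ y.left = u := congrArg CommaMorphism.left hxy
    have hr : x.right ≫ y.right = v := congrArg CommaMorphism.right hxy
    have hy : y.left ≫ q = (W ω).hom ≫ y.right := y.w
    let n : N := ⟨k, ω, x⟩
    obtain ⟨f, hf, hf'⟩ := exists_lift (hq _ ⟨n⟩) (a := y.left) (b := p n ≫ y.right)
      (by rw [reassoc_of% hjp n, hy])
    refine ⟨⟨m n ≫ f, ?_, ?_⟩⟩
    · rw [← reassoc_of% hm n, hf, ← hl]
    · rw [Category.assoc, hf', reassoc_of% hmp n, ← hr]

end SmallGenerators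

/-! ### Existence of the model structure. -/

section ModelStructure

variable {C : Type u} [Category.{w} C] [HasFiniteLimits C] [HasTerminal C]
  [HasColimitsOfSize.{w, w} C] {cyl : FunctorialCylinder C} {L An : MorphismProperty C}

theorem FunctorialCylinder.IsHomotopical.exists_modelCategory [IsLocallyPresentable.{w} C]
    (hA : cyl.IsHomotopical L An) (M S : MorphismProperty C)
    [MorphismProperty.IsSmall.{w} M] [MorphismProperty.IsSmall.{w} S] (hM : M.rlp = L.rlp)
    (hS : S.rlp = An.rlp) :
    ∃ Mod : ModelCategory C, IsInducedModelStructure cyl L An Mod := by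
  obtain ⟨J, _, hJ, hJ'⟩ := hA.exists_small_generators M S hM hS
  -- This is the source of both the description of fibrant objects and that of fibrations between
  -- them.
  have hfib {E B : C} (p : E ⟶ B) (hp : An.rlp p) (hB : An.rlp (terminal.from B)) :
      (L ⊓ cyl.equivalences An).rlp p := fun _ _ i hi =>
    (hA.equivalences_iff_hasLiftingProperty i hi.1).1 hi.2 p hp hB
  have hJL : J.rlp.llp ≤ L ⊓ cyl.equivalences An := fun X Y i hi => by
    have hiL : L i := by
      rw [← hA.llp_rlp]
      exact MorphismProperty.antitone_llp
        (MorphismProperty.antitone_rlp (hJ.trans inf_le_left)) _ hi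
    refine ⟨hiL, (hA.equivalences_iff_hasLiftingProperty i hiL).2 fun E B p hp hB => ?_⟩
    exact hi p (MorphismProperty.antitone_rlp hJ _ (hfib p hp hB))
  have := hasSmallObjectArgument_of_isSmall J
  -- Retract argument: in the factorization of `f`, the right factor is a weak equivalence by
  -- two-out-of-three, so it lifts against `f`.
  have hLJ : L ⊓ cyl.equivalences An ≤ J.rlp.llp := fun X Y f ⟨hf, hf'⟩ => by
    let h := MorphismProperty.factorizationData J.rlp.llp J.rlp f
    have hp : L.rlp h.p := hJ' _ ⟨h.hp, MorphismProperty.of_precomp _ _ _ (hJL _ h.hi).2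
      (by rwa [h.fac])⟩
    have := hp _ hf
    exact MorphismProperty.of_retract (RetractArrow.ofLeftLiftingProperty h.fac) h.hi
  have hJL : J.rlp.llp = L ⊓ cyl.equivalences An := le_antisymm hJL hLJ
  have hLJ : (L ⊓ cyl.equivalences An).rlp = J.rlp := by
    rw [← hJL, MorphismProperty.rlp_llp_rlp]
  have hLJ' : J.rlp ⊓ cyl.equivalences An = L.rlp := by
    refine le_antisymm hJ' (le_inf ?_ hA.rlp_le_equivalences)
    rw [← hLJ]
    exact MorphismProperty.antitone_rlp inf_le_left
  let _ : CategoryWithFibrations C := ⟨J.rlp⟩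
  let _ : CategoryWithCofibrations C := ⟨L⟩
  let _ : CategoryWithWeakEquivalences C := ⟨cyl.equivalences An⟩
  have : (weakEquivalences C).HasTwoOutOfThreeProperty :=
    inferInstanceAs (cyl.equivalences An).HasTwoOutOfThreeProperty
  have : MorphismProperty.IsWeakFactorizationSystem (cofibrations C) (trivialFibrations C) := by
    change MorphismProperty.IsWeakFactorizationSystem L (J.rlp ⊓ cyl.equivalences An)
    rw [hLJ']
    exact hA.isWeakFactorizationSystem
  have : MorphismProperty.IsWeakFactorizationSystem (trivialCofibrations C) (fibrations C) := by
    change MorphismProperty.IsWeakFactorizationSystem (L ⊓ cyl.equivalences An) J.rlp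
    rw [← hJL]
    exact ⟨MorphismProperty.rlp_llp_rlp _, rfl, inferInstance⟩
  have hAn : J.rlp ≤ An.rlp := by
    rw [← hLJ]
    exact MorphismProperty.antitone_rlp (le_inf hA.an_le hA.le_equivalences)
  have hT : An.rlp (terminal.from (⊤_ C)) := by
    rw [Subsingleton.elim (terminal.from (⊤_ C)) (𝟙 _)]
    exact MorphismProperty.rlp_of_isIso _ _
  have : HasFiniteColimits C := hasFiniteColimits_of_hasColimitsOfSize.{w, w} C
  refine ⟨ModelCategory.mk' C, rfl, rfl, fun X => ⟨hAn _, fun h => ?_⟩,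
    fun f _ hY => ⟨hAn _, fun h => ?_⟩⟩
  · change J.rlp _
    rw [← hLJ]
    exact hfib _ h hT
  · change J.rlp _
    rw [← hLJ]
    exact hfib _ h hY

end ModelStructure

/-! ### A model structure is determined by its cofibrations and fibrant objects. -/

section Uniqueness

variable {C : Type u} [Category.{w} C]

theorem trivialCofibrations_rlp (M : ModelCategory C) :
    (cofibrationsOf M ⊓ weakEquivalencesOf M).rlp = fibrationsOf M :=
  MorphismProperty.rlp_eq_of_wfs (trivialCofibrations C) (fibrations C)

theorem modelCategory_ext {M M' : ModelCategory C} (h : cofibrationsOf M = cofibrationsOf M')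
    (h' : weakEquivalencesOf M = weakEquivalencesOf M') : M = M' := by
  have h'' : fibrationsOf M = fibrationsOf M' := by
    rw [← trivialCofibrations_rlp, ← trivialCofibrations_rlp, h, h']
  obtain ⟨⟨a⟩, ⟨b⟩, ⟨c⟩⟩ := M
  obtain ⟨⟨a'⟩, ⟨b'⟩, ⟨c'⟩⟩ := M'
  obtain rfl : a = a' := h''
  obtain rfl : b = b' := h
  obtain rfl : c = c' := h'
  rfl

/-- The relation on morphisms of being homotopic with respect to a cylinder object `P` whose
projection has the right lifting property with respect to `L`. -/
def RlpHomotopic (L : MorphismProperty C) {X W : C} (f g : X ⟶ W) : Prop :=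
  ∃ (P : C) (i₀ i₁ : X ⟶ P) (π : P ⟶ X) (h : P ⟶ W),
    L.rlp π ∧ i₀ ≫ π = 𝟙 X ∧ i₁ ≫ π = 𝟙 X ∧ i₀ ≫ h = f ∧ i₁ ≫ h = g

theorem RlpHomotopic.comp_right {L : MorphismProperty C} {X W Z : C} {f g : X ⟶ W}
    (h : RlpHomotopic L f g) (k : W ⟶ Z) : RlpHomotopic L (f ≫ k) (g ≫ k) := by
  obtain ⟨P, i₀, i₁, π, h, hπ, h₀, h₁, rfl, rfl⟩ := h
  exact ⟨P, i₀, i₁, π, h ≫ k, hπ, h₀, h₁, by simp, by simp⟩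

variable [HasTerminal C]

section

variable (M : ModelCategory C)

/-- For fibrant `W` a left homotopy can be moved to a cylinder whose projection is a trivial
fibration. The resulting relation mentions only the cofibrations, so it can be compared between
model structures. -/
theorem leftHomotopyRel_iff_rlpHomotopic {X W : C} (hW : fibrationsOf M (terminal.from W))
    (f g : X ⟶ W) : LeftHomotopyRel f g ↔ RlpHomotopic (cofibrationsOf M) f g := by
  have : IsFibrant W := ⟨hW⟩
  unfold RlpHomotopic
  rw [show (cofibrationsOf M).rlp = trivialFibrations C from
    MorphismProperty.rlp_eq_of_wfs (cofibrations C) (trivialFibrations C)]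
  constructor
  · intro h
    obtain ⟨P, _, ⟨h⟩⟩ := h.exists_very_good_cylinder
    exact ⟨P.I, P.i₀, P.i₁, P.π, h.h, mem_trivialFibrations _, by simp, by simp, by simp, by simp⟩
  · rintro ⟨P, i₀, i₁, π, h, hπ, h₀, h₁, rfl, rfl⟩
    have := (mem_trivialFibrations_iff π).1 hπ |>.2
    let Q : Cylinder X := { I := P, i₀ := i₀, i₁ := i₁, π := π }
    exact ⟨Q, ⟨{ h := h }⟩⟩

theorem RlpHomotopic.comp_left {X Y W : C} {f g : X ⟶ W} (hW : fibrationsOf M (terminal.from W))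
    (h : RlpHomotopic (cofibrationsOf M) f g) (k : Y ⟶ X) :
    RlpHomotopic (cofibrationsOf M) (k ≫ f) (k ≫ g) := by
  have : IsFibrant W := ⟨hW⟩
  simp only [← leftHomotopyRel_iff_rlpHomotopic M hW] at h ⊢
  exact h.precomp k

variable [HasInitial C] (hc : ∀ X : C, cofibrationsOf M (initial.to X))

include hc

theorem equivalence_rlpHomotopic (X : C) {W : C} (hW : fibrationsOf M (terminal.from W)) :
    Equivalence (RlpHomotopic (cofibrationsOf M) (X := X) (W := W)) := by
  have : IsCofibrant X := ⟨hc X⟩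
  have h := LeftHomotopyRel.equivalence X W
  constructor
  · intro f
    exact (leftHomotopyRel_iff_rlpHomotopic M hW _ _).1 (h.refl f)
  · intro f g
    simp only [← leftHomotopyRel_iff_rlpHomotopic M hW]
    exact h.symm
  · intro f g k
    simp only [← leftHomotopyRel_iff_rlpHomotopic M hW]
    exact h.trans

theorem rlpHomotopic_bijective_of_weakEquivalence {X Y W : C} (f : X ⟶ Y)
    (hf : weakEquivalencesOf M f) (hW : fibrationsOf M (terminal.from W)) :
    (∀ g : X ⟶ W, ∃ g', RlpHomotopic (cofibrationsOf M) (f ≫ g') g) ∧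
      ∀ g g' : Y ⟶ W, RlpHomotopic (cofibrationsOf M) (f ≫ g) (f ≫ g') →
        RlpHomotopic (cofibrationsOf M) g g' := by
  have : IsCofibrant X := ⟨hc X⟩
  have : IsCofibrant Y := ⟨hc Y⟩
  have : IsFibrant W := ⟨hW⟩
  have : WeakEquivalence f := ⟨hf⟩
  have h := RightHomotopyClass.precomp_bijective_of_weakEquivalence W f
  simp only [← leftHomotopyRel_iff_rlpHomotopic M hW, leftHomotopyRel_iff_rightHomotopyRel]
  refine ⟨fun g => ?_, fun g g' w => ?_⟩
  · obtain ⟨g', hg'⟩ := h.2 (.mk g)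
    obtain ⟨g', rfl⟩ := g'.mk_surjective
    exact ⟨g', (RightHomotopyClass.mk_eq_mk_iff _ _).1 hg'⟩
  · exact (RightHomotopyClass.mk_eq_mk_iff _ _).1 (@h.1 (.mk g) (.mk g')
      (RightHomotopyClass.sound w))

/-- The covering homotopy property replaces `s` by a strict section `s'`. Then `q ≫ s'` is homotopic
to the identity, hence a weak equivalence, and `q` is a retract of it. -/
theorem weakEquivalence_of_rlpHomotopic {X Y : C} (q : X ⟶ Y) (s : Y ⟶ X)
    (hX : fibrationsOf M (terminal.from X)) (hY : fibrationsOf M (terminal.from Y))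
    (hq : fibrationsOf M q) (h₁ : RlpHomotopic (cofibrationsOf M) (q ≫ s) (𝟙 X))
    (h₂ : RlpHomotopic (cofibrationsOf M) (s ≫ q) (𝟙 Y)) : weakEquivalencesOf M q := by
  rw [← leftHomotopyRel_iff_rlpHomotopic M hX] at h₁
  rw [← leftHomotopyRel_iff_rlpHomotopic M hY] at h₂
  have : IsCofibrant X := ⟨hc X⟩
  have : IsCofibrant Y := ⟨hc Y⟩
  have : IsFibrant X := ⟨hX⟩
  have : Fibration q := ⟨hq⟩
  obtain ⟨P, _, ⟨h₂⟩⟩ := h₂.exists_good_cylinder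
  obtain ⟨s', H, hH⟩ := h₂.covering_homotopy q s
  have hs' : s' ≫ q = 𝟙 Y := by
    rw [← H.h₁, Category.assoc, hH, h₂.h₁]
  have h₃ : LeftHomotopyRel (q ≫ s') (𝟙 X) :=
    (LeftHomotopyRel.precomp H.leftHomotopyRel.symm q).trans h₁
  obtain ⟨Q, ⟨h₃⟩⟩ := h₃
  have : WeakEquivalence (q ≫ s') := h₃.weakEquivalence_iff.2 inferInstance
  let r : RetractArrow q (q ≫ s') :=
    { i := Arrow.homMk (𝟙 _) s'
      r := Arrow.homMk (𝟙 _) q (by simp [hs'])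
      retract := by ext <;> simp [hs'] }
  exact MorphismProperty.of_retract (P := weakEquivalences C) r this.mem

end

/-- Up to weak equivalences of `M'`, the map `f` becomes an `M'`-fibration `q` between fibrant
objects. Both structures have the same homotopy classes of maps into fibrant objects, so `q` induces
bijections on them and has a homotopy inverse by a Yoneda argument. -/
theorem weakEquivalencesOf_le [HasInitial C] (M M' : ModelCategory C)
    (h : cofibrationsOf M = cofibrationsOf M') (hc : ∀ X : C, cofibrationsOf M' (initial.to X))
    (h' : ∀ X : C, fibrationsOf M (terminal.from X) ↔ fibrationsOf M' (terminal.from X)) :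
    weakEquivalencesOf M ≤ weakEquivalencesOf M' := fun X Y f hf => by
  have hc' : ∀ X : C, cofibrationsOf M (initial.to X) := by rwa [h]
  have hfac {X Y : C} (g : X ⟶ Y) : ∃ (Z : C) (j : X ⟶ Z) (q : Z ⟶ Y),
      weakEquivalencesOf M' j ∧ fibrationsOf M' q ∧ j ≫ q = g := by
    let F := MorphismProperty.factorizationData (@trivialCofibrations C _ _ _) (@fibrations C _ _) g
    exact ⟨F.Z, F.i, F.p, F.hi.2, F.hp, F.fac⟩
  obtain ⟨Y', j, p, hj, hp, -⟩ := hfac (terminal.from Y)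
  obtain rfl := Subsingleton.elim p (terminal.from Y')
  obtain ⟨X', k, q, hk, hq, w⟩ := hfac (f ≫ j)
  have hX' : fibrationsOf M' (terminal.from X') := by
    rw [← terminal.comp_from q]
    exact MorphismProperty.comp_mem (fibrations C) _ _ hq hp
  have key (W : C) (hW : fibrationsOf M' (terminal.from W)) :
      (∀ g : X' ⟶ W, ∃ g', RlpHomotopic (cofibrationsOf M') (q ≫ g') g) ∧
      ∀ g g' : Y' ⟶ W, RlpHomotopic (cofibrationsOf M') (q ≫ g) (q ≫ g') →
        RlpHomotopic (cofibrationsOf M') g g' := by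
    have h₁ := rlpHomotopic_bijective_of_weakEquivalence M hc' f hf ((h' W).2 hW)
    have h₂ := rlpHomotopic_bijective_of_weakEquivalence M' hc j hj hW
    have h₃ := rlpHomotopic_bijective_of_weakEquivalence M' hc k hk hW
    have hE (X : C) := equivalence_rlpHomotopic M' hc X hW
    rw [h] at h₁
    constructor
    · intro g
      obtain ⟨g₁, hg₁⟩ := h₁.1 (k ≫ g)
      obtain ⟨g₂, hg₂⟩ := h₂.1 g₁
      refine ⟨g₂, h₃.2 _ _ ?_⟩
      rw [reassoc_of% w]
      exact (hE _).trans (hg₂.comp_left M' hW f) hg₁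
    · intro g g' hg
      refine h₂.2 _ _ (h₁.2 _ _ ?_)
      have := hg.comp_left M' hW k
      rwa [reassoc_of% w, reassoc_of% w] at this
  obtain ⟨s, hs⟩ := (key X' hX').1 (𝟙 X')
  have hs' : RlpHomotopic (cofibrationsOf M') (s ≫ q) (𝟙 Y') := by
    refine (key Y' hp).2 _ _ ?_
    simpa using hs.comp_right q
  have hq' := weakEquivalence_of_rlpHomotopic M' hc q s hX' hp hq hs hs'
  have hfj : weakEquivalences C (f ≫ j) := by
    rw [← w]
    exact MorphismProperty.comp_mem (weakEquivalences C) _ _ hk hq'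
  exact MorphismProperty.of_postcomp (weakEquivalences C) (W' := weakEquivalences C) _ _ hj hfj

theorem modelCategory_ext_of_fibrant [HasInitial C] (M M' : ModelCategory C)
    (h : cofibrationsOf M = cofibrationsOf M') (hc : ∀ X : C, cofibrationsOf M (initial.to X))
    (h' : ∀ X : C, fibrationsOf M (terminal.from X) ↔ fibrationsOf M' (terminal.from X)) :
    M = M' :=
  modelCategory_ext h (le_antisymm
    (weakEquivalencesOf_le M M' h (by rwa [← h]) h')
    (weakEquivalencesOf_le M' M h.symm hc fun X => (h' X).symm))

end Uniqueness

/-! ### Lifting properties of corner maps. -/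

section BoxMap

variable {C : Type u} [Category.{w} C]

section

variable [HasPushouts C] {F G : C ⥤ C} (η : F ⟶ G)

theorem inl_boxMap {K L : C} (i : K ⟶ L) : pushout.inl _ _ ≫ boxMap η i = η.app L :=
  pushout.inl_desc _ _ _

theorem inl_boxMap_assoc {K L Z : C} (i : K ⟶ L) (h : G.obj L ⟶ Z) :
    pushout.inl _ _ ≫ boxMap η i ≫ h = η.app L ≫ h := by
  rw [reassoc_of% inl_boxMap η i]

theorem inr_boxMap {K L : C} (i : K ⟶ L) : pushout.inr _ _ ≫ boxMap η i = G.map i :=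
  pushout.inr_desc _ _ _

theorem inr_boxMap_assoc {K L Z : C} (i : K ⟶ L) (h : G.obj L ⟶ Z) :
    pushout.inr _ _ ≫ boxMap η i ≫ h = G.map i ≫ h := by
  rw [reassoc_of% inr_boxMap η i]

theorem hasLiftingProperty_boxMap_iff {K L E B : C} (i : K ⟶ L) (p : E ⟶ B) :
    HasLiftingProperty (boxMap η i) p ↔ ∀ (u : F.obj L ⟶ E) (v : G.obj K ⟶ E) (b : G.obj L ⟶ B),
      F.map i ≫ u = η.app K ≫ v → u ≫ p = η.app L ≫ b → v ≫ p = G.map i ≫ b →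
      ∃ H : G.obj L ⟶ E, η.app L ≫ H = u ∧ G.map i ≫ H = v ∧ H ≫ p = b := by
  constructor
  · intro h u v b w₁ w₂ w₃
    obtain ⟨H, h₁, h₂⟩ := exists_lift h (a := pushout.desc u v w₁) (b := b) (by
      apply pushout.hom_ext
      · rw [pushout.inl_desc_assoc, inl_boxMap_assoc, w₂]
      · rw [pushout.inr_desc_assoc, inr_boxMap_assoc, w₃])
    refine ⟨H, ?_, ?_, h₂⟩
    · rw [← inl_boxMap_assoc η i, h₁, pushout.inl_desc]
    · rw [← inr_boxMap_assoc η i, h₁, pushout.inr_desc]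
  · refine fun h => ⟨fun {f b} sq => ?_⟩
    obtain ⟨H, h₁, h₂, h₃⟩ := h (pushout.inl _ _ ≫ f) (pushout.inr _ _ ≫ f) b
      (pushout.condition_assoc _) (by rw [Category.assoc, sq.w, inl_boxMap_assoc])
      (by rw [Category.assoc, sq.w, inr_boxMap_assoc])
    refine ⟨⟨H, ?_, h₃⟩⟩
    apply pushout.hom_ext
    · rw [inl_boxMap_assoc, h₁]
    · rw [inr_boxMap_assoc, h₂]

/-- Let `F'` and `G'` be the right adjoints and `μ` the mate of `η`. By transposition, `boxMap η i`
lifts against `p` if and only if `i` lifts against `G' E ⟶ F' E ×_{F' B} G' B`; the class of such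
`i` is therefore a left lifting class. -/
theorem hasLiftingProperty_boxMap_of_llp_rlp [HasPullbacks C] [F.IsLeftAdjoint] [G.IsLeftAdjoint]
    {S : MorphismProperty C} {E B : C} {p : E ⟶ B}
    (h : ∀ ⦃K L : C⦄ (i : K ⟶ L), S i → HasLiftingProperty (boxMap η i) p)
    {K L : C} (i : K ⟶ L) (hi : S.rlp.llp i) : HasLiftingProperty (boxMap η i) p := by
  let adjF := Adjunction.ofIsLeftAdjoint F
  let adjG := Adjunction.ofIsLeftAdjoint G
  let F' := F.rightAdjoint
  let G' := G.rightAdjoint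
  let μ : G' ⟶ F' := conjugateEquiv adjG adjF η
  have hμ {X Y : C} (x : G.obj X ⟶ Y) :
      adjF.homEquiv _ _ (η.app X ≫ x) = adjG.homEquiv _ _ x ≫ μ.app Y := by
    simp only [adjF.homEquiv_unit, adjG.homEquiv_unit, Category.assoc]
    rw [F'.map_comp, ← reassoc_of% unit_conjugateEquiv adjG adjF η X]
    exact congrArg (adjG.unit.app X ≫ ·) (μ.naturality x).symm
  let q : G'.obj E ⟶ pullback (F'.map p) (μ.app B) :=
    pullback.lift (μ.app E) (G'.map p) (μ.naturality p).symm
  have key {K L : C} (i : K ⟶ L) : HasLiftingProperty (boxMap η i) p ↔ HasLiftingProperty i q := by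
    rw [hasLiftingProperty_boxMap_iff]
    have hq₁ : q ≫ pullback.fst _ _ = μ.app E := pullback.lift_fst _ _ _
    have hq₂ : q ≫ pullback.snd _ _ = G'.map p := pullback.lift_snd _ _ _
    constructor
    · refine fun h => ⟨fun {x y} sq => ?_⟩
      obtain ⟨v, rfl⟩ := (adjG.homEquiv _ _).surjective x
      obtain ⟨u, hu⟩ := (adjF.homEquiv _ _).surjective (y ≫ pullback.fst _ _)
      obtain ⟨b, hb⟩ := (adjG.homEquiv _ _).surjective (y ≫ pullback.snd _ _)
      obtain ⟨H, h₁, h₂, h₃⟩ := h u v b ((adjF.homEquiv _ _).injective (by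
          rw [adjF.homEquiv_naturality_left, hu, hμ, ← hq₁, ← Category.assoc, ← Category.assoc,
            sq.w]))
        ((adjF.homEquiv _ _).injective (by
          rw [adjF.homEquiv_naturality_right, hu, hμ, hb, Category.assoc, Category.assoc,
            pullback.condition]))
        ((adjG.homEquiv _ _).injective (by
          rw [adjG.homEquiv_naturality_right, adjG.homEquiv_naturality_left, hb, ← hq₂,
            ← Category.assoc, ← Category.assoc, sq.w]))
      refine ⟨⟨adjG.homEquiv _ _ H, ?_, ?_⟩⟩
      · rw [← adjG.homEquiv_naturality_left, h₂]
      · apply pullback.hom_ext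
        · rw [Category.assoc, hq₁, ← hμ, h₁, hu]
        · rw [Category.assoc, hq₂, ← adjG.homEquiv_naturality_right, h₃, hb]
    · intro h u v b w₁ w₂ w₃
      obtain ⟨H, h₁, h₂⟩ := exists_lift h (a := adjG.homEquiv _ _ v)
        (b := pullback.lift (adjF.homEquiv _ _ u) (adjG.homEquiv _ _ b) (by
          rw [← adjF.homEquiv_naturality_right, w₂, hμ])) (by
            apply pullback.hom_ext
            · rw [Category.assoc, Category.assoc, hq₁, pullback.lift_fst, ← hμ, ← w₁,
                adjF.homEquiv_naturality_left]
            · rw [Category.assoc, Category.assoc, hq₂, pullback.lift_snd,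
                ← adjG.homEquiv_naturality_right, w₃, adjG.homEquiv_naturality_left])
      obtain ⟨H, rfl⟩ := (adjG.homEquiv _ _).surjective H
      refine ⟨H, ?_, ?_, ?_⟩
      · apply (adjF.homEquiv _ _).injective
        rw [hμ, ← hq₁, ← Category.assoc, h₂, pullback.lift_fst]
      · apply (adjG.homEquiv _ _).injective
        rw [adjG.homEquiv_naturality_left, h₁]
      · apply (adjG.homEquiv _ _).injective
        rw [adjG.homEquiv_naturality_right, ← hq₂, ← Category.assoc, h₂, pullback.lift_snd]
  exact (key i).2 (hi q fun _ _ s hs => (key s).1 (h s hs))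

end

end BoxMap

/-! ### Passage to slice categories. -/

section Over

variable {C : Type u} [Category.{w} C]

theorem isCardinalPresentable_of_exists (κ : Cardinal.{w}) [Fact κ.IsRegular] (X : C)
    (h₁ : ∀ {J : Type w} [SmallCategory J] [IsCardinalFiltered J κ] {F : J ⥤ C} {c : Cocone F}
      (_ : IsColimit c) (f : X ⟶ c.pt), ∃ (j : J) (g : X ⟶ F.obj j), g ≫ c.ι.app j = f)
    (h₂ : ∀ {J : Type w} [SmallCategory J] [IsCardinalFiltered J κ] {F : J ⥤ C} {c : Cocone F}
      (_ : IsColimit c) (j : J) (f g : X ⟶ F.obj j), f ≫ c.ι.app j = g ≫ c.ι.app j →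
      ∃ (k : J) (u : j ⟶ k), f ≫ F.map u = g ≫ F.map u) :
    IsCardinalPresentable X κ where
  preservesColimitOfShape J _ _ :=
    { preservesColimit {F} :=
        { preserves {c} hc := by
            have := isFiltered_of_isCardinalFiltered J κ
            refine ⟨Types.FilteredColimit.isColimitOf' _ _ (fun f => ?_) (fun j f g h => ?_)⟩
            · obtain ⟨j, g, hg⟩ := h₁ hc f
              exact ⟨j, g, hg.symm⟩
            · exact h₂ hc j f g h } }

variable {A : C}

instance (κ : Cardinal.{w}) [Fact κ.IsRegular] [HasColimitsOfSize.{w, w} C] {X : C}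
    [IsCardinalPresentable X κ] (g : X ⟶ A) : IsCardinalPresentable (Over.mk g) κ := by
  refine isCardinalPresentable_of_exists κ _ ?_ ?_
  · intro J _ _ F c hc f
    have := essentiallySmallSelf J
    have hc' := isColimitOfPreserves (Over.forget A) hc
    obtain ⟨j, x, hx⟩ := IsCardinalPresentable.exists_hom_of_isColimit (X := X) κ hc' f.left
    dsimp at x hx
    refine ⟨j, Over.homMk x ?_, by ext; exact hx⟩
    have h₁ := Over.w (c.ι.app j)
    have h₂ := Over.w f
    dsimp at h₁ h₂ ⊢
    rw [← h₂, ← hx, Category.assoc, h₁]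
  · intro J _ _ F c hc j f g h
    have := essentiallySmallSelf J
    have hc' := isColimitOfPreserves (Over.forget A) hc
    obtain ⟨k, u, hu⟩ := IsCardinalPresentable.exists_eq_of_isColimit' (X := X) κ hc' f.left g.left
      (congrArg CommaMorphism.left h)
    exact ⟨k, u, by ext; exact hu⟩

instance [IsLocallyPresentable.{w} C] [HasFiniteLimits C] : IsLocallyPresentable.{w} (Over A) := by
  obtain ⟨κ, _, _⟩ := IsLocallyPresentable.exists_cardinal.{w} C
  obtain ⟨ι, G, _, h⟩ := exists_isDetecting κ C
  have : HasColimitsOfSize.{w, w} (Over A) := ⟨inferInstance⟩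
  refine ⟨κ, inferInstance, isCardinalLocallyPresentable_of_isDetecting κ
    (fun i : Σ i, G i ⟶ A => Over.mk i.2) fun X Y f hf => ?_⟩
  have : IsIso f.left := h _ <| by
    rintro _ ⟨i⟩ g
    obtain ⟨g', hg', hg''⟩ := hf _ ⟨(⟨i, g ≫ Y.hom⟩ : Σ i, G i ⟶ A)⟩ (Over.homMk g)
    refine ⟨g'.left, congrArg CommaMorphism.left hg', fun k hk => ?_⟩
    refine congrArg CommaMorphism.left (hg'' (Over.homMk k ?_) ?_)
    · have := Over.w f
      dsimp at this hk ⊢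
      rw [← this, reassoc_of% hk]
    · ext
      exact hk
  have : IsIso ((Over.forget A).map f) := this
  exact isIso_of_reflects_iso f (Over.forget A)

/-- A lift found in `C` is automatically a morphism over `A`, because its composite with `p` is. -/
theorem comp_hom_of_comp_left {T E B : Over A} (p : E ⟶ B) (b : T ⟶ B) {l : T.left ⟶ E.left}
    (h : l ≫ p.left = b.left) : l ≫ E.hom = T.hom := by
  rw [← Over.w p, reassoc_of% h]
  exact Over.w b

theorem hasLiftingProperty_left_iff {K X : C} (i : K ⟶ X) {E B : Over A} (p : E ⟶ B) :
    HasLiftingProperty i p.left ↔ ∀ g : X ⟶ A,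
      HasLiftingProperty (Over.homMk i : Over.mk (i ≫ g) ⟶ Over.mk g) p := by
  constructor
  · refine fun h g => ⟨fun {a b} sq => ?_⟩
    obtain ⟨l, h₁, h₂⟩ := exists_lift h (congrArg CommaMorphism.left sq.w)
    refine ⟨⟨Over.homMk l ?_, by ext; exact h₁, by ext; exact h₂⟩⟩
    exact comp_hom_of_comp_left p b h₂
  · refine fun h => ⟨fun {a b} sq => ?_⟩
    obtain ⟨l, h₁, h₂⟩ := exists_lift (h (b ≫ B.hom))
      (a := Over.homMk a (by rw [← Over.w p, reassoc_of% sq.w]; rfl))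
      (b := Over.homMk b) (by ext; exact sq.w)
    exact ⟨⟨l.left, congrArg CommaMorphism.left h₁, congrArg CommaMorphism.left h₂⟩⟩

theorem rlp_over (P : MorphismProperty C) : P.over.rlp = P.rlp.over (X := A) := by
  ext E B p
  constructor
  · intro h K X i hi
    exact (hasLiftingProperty_left_iff i p).2 fun g => h _ hi
  · intro h K X i hi
    refine ⟨fun {a b} sq => ?_⟩
    obtain ⟨l, h₁, h₂⟩ := exists_lift (h i.left hi) (congrArg CommaMorphism.left sq.w)
    refine ⟨⟨Over.homMk l ?_, by ext; exact h₁, by ext; exact h₂⟩⟩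
    exact comp_hom_of_comp_left p b h₂

/-- A generator is taken once for each structure map of its codomain to `A`; these maps form a small
set. -/
theorem exists_isSmall_rlp_eq_over (P : MorphismProperty C) [MorphismProperty.IsSmall.{w} P] :
    ∃ S : MorphismProperty (Over A), MorphismProperty.IsSmall.{w} S ∧ S.rlp = P.rlp.over := by
  let s := fun x : Σ f : P.toSet, (f.1.right ⟶ A) =>
    (Over.homMk x.1.1.hom : Over.mk (x.1.1.hom ≫ x.2) ⟶ Over.mk x.2)
  refine ⟨.ofHoms s, inferInstance, ?_⟩
  rw [← rlp_over]
  apply le_antisymm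
  · intro E B p hp
    rw [rlp_over]
    intro K X i hi
    exact (hasLiftingProperty_left_iff i p).2 fun g =>
      hp _ ⟨(⟨⟨Arrow.mk i, hi⟩, g⟩ : Σ f : P.toSet, (f.1.right ⟶ A))⟩
  · refine MorphismProperty.antitone_rlp ?_
    rintro _ _ _ ⟨⟨f, g⟩⟩
    exact f.2

theorem rlp_over_terminal_iff (P : MorphismProperty C) (X : Over A) :
    P.over.rlp (terminal.from X) ↔ P.rlp X.hom := by
  have : IsIso (⊤_ Over A).hom := by
    let e := terminalIsTerminal.uniqueUpToIso (Over.mkIdTerminal (X := A))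
    have h : e.hom.left = (⊤_ Over A).hom := 
      (Category.comp_id e.hom.left).symm.trans (Over.w e.hom)
    rw [← h]
    exact inferInstanceAs (IsIso ((Over.forget A).map e.hom))
  rw [rlp_over, ← Over.w (terminal.from X)]
  exact (MorphismProperty.cancel_right_of_respectsIso P.rlp (terminal.from X).left _).symm

theorem isWeakFactorizationSystem_over {P : MorphismProperty C}
    (h : P.IsWeakFactorizationSystem P.rlp) :
    (P.over (X := A)).IsWeakFactorizationSystem P.over.rlp := by
  have : P.IsStableUnderRetracts := by rw [← h.llp]; infer_instance
  rw [rlp_over]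
  have : (P.over (X := A)).IsStableUnderRetracts :=
    inferInstanceAs (P.inverseImage (Over.forget A)).IsStableUnderRetracts
  have : (P.rlp.over (X := A)).IsStableUnderRetracts :=
    inferInstanceAs (P.rlp.inverseImage (Over.forget A)).IsStableUnderRetracts
  refine .mk' _ _ fun i p hi hp => ?_
  rw [← rlp_over] at hp
  exact hp i hi

namespace FunctorialCylinder

variable {cyl : FunctorialCylinder C}

theorem EndpointLifting.over {K X E B : Over A} {i : K ⟶ X} {p : E ⟶ B}
    (h : cyl.EndpointLifting i.left p.left) : (cyl.overCylinder A).EndpointLifting i p := by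
  intro u v b w₀ w₁ w₂
  obtain ⟨H, h₀, h₁, h₂⟩ := h u.left v.left b.left (congrArg CommaMorphism.left w₀)
    (congrArg CommaMorphism.left w₁) (congrArg CommaMorphism.left w₂)
  refine ⟨Over.homMk H ?_, by ext; exact h₀, by ext; exact h₁, by ext; exact h₂⟩
  exact comp_hom_of_comp_left (T := (cyl.overCylinder A).I.obj X) p b h₂

theorem BoundaryLifting.over {K X E B : Over A} {i : K ⟶ X} {p : E ⟶ B}
    (h : cyl.BoundaryLifting i.left p.left) : (cyl.overCylinder A).BoundaryLifting i p := by
  intro u₀ u₁ v b w₀ w₁ w₂ w₃ w₄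
  obtain ⟨H, h₀, h₁, h₂, h₃⟩ := h u₀.left u₁.left v.left b.left (congrArg CommaMorphism.left w₀)
    (congrArg CommaMorphism.left w₁) (congrArg CommaMorphism.left w₂)
    (congrArg CommaMorphism.left w₃) (congrArg CommaMorphism.left w₄)
  refine ⟨Over.homMk H ?_, by ext; exact h₀, by ext; exact h₁, by ext; exact h₂, by ext; exact h₃⟩
  exact comp_hom_of_comp_left (T := (cyl.overCylinder A).I.obj X) p b h₃

/-- An object of `Over A` whose domain is initial is initial. -/
def isInitialOver {X : Over A} (h : IsInitial X.left) : IsInitial X :=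
  IsInitial.ofUniqueHom (fun Y => Over.homMk (h.to Y.left) (h.hom_ext _ _))
    fun _ _ => by ext; exact h.hom_ext _ _

theorem IsHomotopical.over [HasColimitsOfSize.{w, w} C] [cyl.I.IsLeftAdjoint]
    {L An : MorphismProperty C} (h : cyl.IsHomotopical L An) :
    (cyl.overCylinder A).IsHomotopical L.over An.over where
  isWeakFactorizationSystem := isWeakFactorizationSystem_over h.isWeakFactorizationSystem
  isWeakFactorizationSystem_an := isWeakFactorizationSystem_over h.isWeakFactorizationSystem_an
  an_le _ _ _ hf := h.an_le _ hf
  initial_to X := by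
    have e : IsInitial (⊥_ Over A).left :=
      (initialIsInitial (C := Over A)).isInitialObj (Over.forget A)
    have : L.RespectsIso := by rw [← h.isWeakFactorizationSystem.llp]; infer_instance
    refine (MorphismProperty.arrow_mk_iso_iff L (Arrow.isoMk
      (initialIsInitial.uniqueUpToIso e) (Iso.refl _) ?_)).1 (h.initial_to X.left)
    exact (initialIsInitial (C := C)).hom_ext _ _
  nonempty_isInitial := by
    have e : IsInitial (⊥_ Over A).left :=
      (initialIsInitial (C := Over A)).isInitialObj (Over.forget A)
    exact ⟨isInitialOver (e.isInitialObj cyl.I)⟩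
  exists_desc {X Y W} a b := by
    have e := mapIsColimitOfPreservesOfIsColimit (Over.forget A ⋙ cyl.I) _ _ (coprodIsCoprod X Y)
    obtain ⟨l, h₁, h₂⟩ := BinaryCofan.IsColimit.desc' e a.left b.left
    refine ⟨Over.homMk l ?_, by ext; exact h₁, by ext; exact h₂⟩
    refine BinaryCofan.IsColimit.hom_ext e ?_ ?_
    · refine (Category.assoc _ _ _).symm.trans ((congrArg (· ≫ W.hom) h₁).trans ?_)
      exact (Over.w a).trans
        (Over.w ((cyl.overCylinder A).I.map (coprod.inl (X := X) (Y := Y)))).symm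
    · refine (Category.assoc _ _ _).symm.trans ((congrArg (· ≫ W.hom) h₂).trans ?_)
      exact (Over.w b).trans
        (Over.w ((cyl.overCylinder A).I.map (coprod.inr (X := X) (Y := Y)))).symm
  hom_ext {X Y W a b} h₀ h₁ := by
    have e := mapIsColimitOfPreservesOfIsColimit (Over.forget A ⋙ cyl.I) _ _ (coprodIsCoprod X Y)
    ext
    exact BinaryCofan.IsColimit.hom_ext e (congrArg CommaMorphism.left h₀)
      (congrArg CommaMorphism.left h₁)
  endpointLifting i p hi hp :=
    (h.endpointLifting i.left p.left hi (by rwa [rlp_over] at hp)).over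
  boundaryLifting i p hi hp :=
    (h.boundaryLifting i.left p.left hi (by rwa [rlp_over] at hp)).over
  boundaryLifting_an i p hi hp :=
    (h.boundaryLifting_an i.left p.left hi (by rwa [rlp_over] at hp)).over

end FunctorialCylinder

end Over

/-! ### From generating sets to the axioms for a cylinder. -/

section Generators

variable {C : Type u} [Category.{w} C]

theorem twoCopies_isLeftAdjoint [HasBinaryCoproducts C] [HasBinaryProducts C] :
    (twoCopies C).IsLeftAdjoint :=
  (Adjunction.mkOfHomEquiv
    { homEquiv X Y :=
        { toFun f := prod.lift (coprod.inl ≫ f) (coprod.inr ≫ f)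
          invFun g := coprod.desc (g ≫ prod.fst) (g ≫ prod.snd)
          left_inv f := by
            apply coprod.hom_ext
            · rw [coprod.inl_desc, prod.lift_fst]
            · rw [coprod.inr_desc, prod.lift_snd]
          right_inv g := by
            apply prod.hom_ext
            · rw [prod.lift_fst, coprod.inl_desc]
            · rw [prod.lift_snd, coprod.inr_desc] }
      homEquiv_naturality_left_symm f g := by
        change coprod.desc ((f ≫ g) ≫ prod.fst) ((f ≫ g) ≫ prod.snd) =
          coprod.map f f ≫ coprod.desc (g ≫ prod.fst) (g ≫ prod.snd)
        rw [coprod.map_desc, Category.assoc, Category.assoc]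
      homEquiv_naturality_right f g := by
        change prod.lift (coprod.inl ≫ f ≫ g) (coprod.inr ≫ f ≫ g) =
          prod.lift (coprod.inl ≫ f) (coprod.inr ≫ f) ≫ prod.map g g
        rw [prod.lift_map]
        exact congrArg₂ prod.lift (Category.assoc _ _ _).symm (Category.assoc _ _ _).symm } :
    twoCopies C ⊣ { obj X := X ⨯ X, map f := prod.map f f }).isLeftAdjoint

namespace FunctorialCylinder

variable (cyl : FunctorialCylinder C)

section

variable [HasPushouts C]

theorem endpointLifting_of_boxMap {K X E B : C} {i : K ⟶ X} {p : E ⟶ B}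
    (h : HasLiftingProperty (boxMap cyl.d₁ i) p) : cyl.EndpointLifting i p :=
  (hasLiftingProperty_boxMap_iff _ _ _).1 h

variable {cyl} in
omit [HasPushouts C] in
theorem BoundaryLifting.symm {K X E B : C} {i : K ⟶ X} {p : E ⟶ B} (h : cyl.BoundaryLifting i p) :
    cyl.symm.BoundaryLifting i p := by
  intro u₀ u₁ v b w₀ w₁ w₂ w₃ w₄
  obtain ⟨H, h₀, h₁, h₂⟩ := h u₁ u₀ v b w₁ w₀ w₃ w₂ w₄
  exact ⟨H, h₁, h₀, h₂⟩

theorem boundaryLifting_of_boxMap [HasBinaryCoproducts C] {K X E B : C} {i : K ⟶ X} {p : E ⟶ B}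
    (h : HasLiftingProperty (boxMap cyl.boundary i) p) : cyl.BoundaryLifting i p := by
  intro u₀ u₁ v b w₀ w₁ w₂ w₃ w₄
  obtain ⟨H, h₀, h₁, h₂⟩ := (hasLiftingProperty_boxMap_iff _ _ _).1 h (coprod.desc u₀ u₁) v b
    (by
      change coprod.map i i ≫ coprod.desc u₀ u₁ = coprod.desc (cyl.d₀.app K) (cyl.d₁.app K) ≫ v
      rw [coprod.map_desc, coprod.desc_comp, w₀, w₁]
      rfl)
    (by
      change coprod.desc u₀ u₁ ≫ p = coprod.desc (cyl.d₀.app X) (cyl.d₁.app X) ≫ b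
      rw [coprod.desc_comp, coprod.desc_comp, w₂, w₃]
      rfl) w₄
  replace h₀ : coprod.desc (cyl.d₀.app X) (cyl.d₁.app X) ≫ H = coprod.desc u₀ u₁ := h₀
  refine ⟨H, ?_, ?_, h₁, h₂⟩
  · rw [← coprod.inl_desc (cyl.d₀.app X) (cyl.d₁.app X), Category.assoc]
    exact (congrArg (coprod.inl ≫ ·) h₀).trans (coprod.inl_desc _ _)
  · rw [← coprod.inr_desc (cyl.d₀.app X) (cyl.d₁.app X), Category.assoc]
    exact (congrArg (coprod.inr ≫ ·) h₀).trans (coprod.inr_desc _ _)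

variable [HasBinaryCoproducts C] (d : 𝟭 C ⟶ cyl.I) (S M : MorphismProperty C)

instance [MorphismProperty.IsSmall.{w} S] [MorphismProperty.IsSmall.{w} M] :
    MorphismProperty.IsSmall.{w} (cyl.anodyneGenerators d S M) := by
  let s : ℕ × (S.toSet ⊕ M.toSet) → Arrow C := fun x =>
    (fun f : Arrow C => Arrow.mk (boxMap cyl.boundary f.hom))^[x.1]
      (Sum.elim Subtype.val (fun f => Arrow.mk (boxMap d f.1.hom)) x.2)
  have hs {K X : C} (i : K ⟶ X) (hi : cyl.anodyneGenerators d S M i) :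
      Arrow.mk i ∈ Set.range s := by
    induction hi with
    | of i hi => exact ⟨(0, Sum.inl ⟨Arrow.mk i, hi⟩), rfl⟩
    | endpoint i hi => exact ⟨(0, Sum.inr ⟨Arrow.mk i, hi⟩), rfl⟩
    | boundary i hi h =>
      obtain ⟨⟨n, x⟩, hx⟩ := h
      refine ⟨(n + 1, x), ?_⟩
      dsimp only [s] at hx ⊢
      rw [Function.iterate_succ_apply', hx]
      rfl
  exact ⟨small_subset fun f hf => hs f.hom hf⟩

variable {d S M} {L : MorphismProperty C}

theorem anodyneGenerators_le (hS : S ≤ L) (hd : ∀ {K X : C} (i : K ⟶ X), M i → L (boxMap d i))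
    (hb : ∀ {K X : C} (i : K ⟶ X), L i → L (boxMap cyl.boundary i)) :
    cyl.anodyneGenerators d S M ≤ L := by
  intro K X i hi
  induction hi with
  | of i hi => exact hS _ hi
  | endpoint i hi => exact hd i hi
  | boundary i hi h => exact hb i h

variable [HasInitial C] [HasFiniteLimits C] [IsLocallyPresentable.{w} C] [cyl.I.IsLeftAdjoint]
  [MorphismProperty.IsSmall.{w} S] [MorphismProperty.IsSmall.{w} M]

/-- The generators contain `d ⊠ i` only for `i` in `M`; adjointness extends the lifting to all of
`L`. They are closed under `∂I ⊠ -`, which extends in the same way to all anodyne extensions. The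
separate `cyl'` allows the ends to be exchanged while the generators stay fixed. -/
theorem isHomotopical_of_boxMap (cyl' : FunctorialCylinder C) [cyl'.I.IsLeftAdjoint]
    (he : ∀ {K X E B : C} (i : K ⟶ X) (p : E ⟶ B), HasLiftingProperty (boxMap d i) p →
      cyl'.EndpointLifting i p)
    (hb : ∀ {K X E B : C} (i : K ⟶ X) (p : E ⟶ B), HasLiftingProperty (boxMap cyl.boundary i) p →
      cyl'.BoundaryLifting i p)
    (hL : MorphismProperty.IsWeakFactorizationSystem L L.rlp) (hM : M.rlp = L.rlp) (hS : S ≤ L)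
    (hd' : ∀ {K X : C} (i : K ⟶ X), L i → L (boxMap d i))
    (hb' : ∀ {K X : C} (i : K ⟶ X), L i → L (boxMap cyl.boundary i))
    (h₀ : ∀ X, L (initial.to X)) :
    cyl'.IsHomotopical L (cyl.anodyneGenerators d S M).rlp.llp := by
  have hM' : M.rlp.llp = L := by rw [hM, hL.llp]
  have hML : M ≤ L := by rw [← hM']; exact M.le_llp_rlp
  have hΛ : (cyl.anodyneGenerators d S M).rlp.llp.rlp = (cyl.anodyneGenerators d S M).rlp :=
    MorphismProperty.rlp_llp_rlp _
  have := twoCopies_isLeftAdjoint (C := C)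
  have : (𝟭 C).IsLeftAdjoint := inferInstance
  have := hasSmallObjectArgument_of_isSmall (cyl.anodyneGenerators d S M)
  exact
    { isWeakFactorizationSystem := hL
      isWeakFactorizationSystem_an := by
        rw [hΛ]
        exact .mk' _ _ fun i p hi hp => hi p hp
      an_le := by
        conv_rhs => rw [← hL.llp]
        refine MorphismProperty.antitone_llp (MorphismProperty.antitone_rlp ?_)
        exact cyl.anodyneGenerators_le hS (fun i hi => hd' i (hML _ hi)) hb'
      initial_to := h₀
      nonempty_isInitial := ⟨initialIsInitial.isInitialObj cyl'.I⟩
      exists_desc {X Y W} a b := by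
        have e := mapIsColimitOfPreservesOfIsColimit cyl'.I _ _ (coprodIsCoprod X Y)
        obtain ⟨l, h₁, h₂⟩ := BinaryCofan.IsColimit.desc' e a b
        exact ⟨l, h₁, h₂⟩
      hom_ext {X Y W a b} h₀ h₁ := BinaryCofan.IsColimit.hom_ext
        (mapIsColimitOfPreservesOfIsColimit cyl'.I _ _ (coprodIsCoprod X Y)) h₀ h₁
      endpointLifting i p hi hp := by
        rw [hΛ] at hp
        refine he i p (hasLiftingProperty_boxMap_of_llp_rlp d (S := M) (fun _ _ i hi => ?_) i
          (by rwa [hM']))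
        exact hp _ (.endpoint i hi)
      boundaryLifting i p hi hp := hb i p (hp _ (hb' i hi))
      boundaryLifting_an i p hi hp := by
        rw [hΛ] at hp
        refine hb i p (hasLiftingProperty_boxMap_of_llp_rlp cyl.boundary (fun _ _ i hi => ?_) i hi)
        exact hp _ (.boundary i hi) }

end

variable {cyl} {L An : MorphismProperty C}

theorem IsHomotopical.exists_modelCategory_over [HasColimitsOfSize.{w, w} C] [HasFiniteLimits C]
    [IsLocallyPresentable.{w} C] [cyl.I.IsLeftAdjoint] (h : cyl.IsHomotopical L An)
    (M S : MorphismProperty C) [MorphismProperty.IsSmall.{w} M] [MorphismProperty.IsSmall.{w} S]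
    (hM : M.rlp = L.rlp) (hS : S.rlp = An.rlp) (A : C) :
    ∃ Mod : ModelCategory (Over A),
      IsInducedModelStructure (cyl.overCylinder A) L.over An.over Mod ∧
      (∀ X : Over A, fibrationsOf Mod (terminal.from X) ↔ An.rlp X.hom) ∧
      (∀ Mod' : ModelCategory (Over A), cofibrationsOf Mod' = L.over →
        weakEquivalencesOf Mod' = (cyl.overCylinder A).equivalences An.over → Mod' = Mod) ∧
      (∀ Mod' : ModelCategory (Over A), cofibrationsOf Mod' = L.over →
        (∀ X : Over A, fibrationsOf Mod' (terminal.from X) ↔ An.rlp X.hom) → Mod' = Mod) := by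
  obtain ⟨M', _, hM'⟩ := exists_isSmall_rlp_eq_over (A := A) M
  obtain ⟨S', _, hS'⟩ := exists_isSmall_rlp_eq_over (A := A) S
  have : HasColimitsOfSize.{w, w} (Over A) := ⟨inferInstance⟩
  have hA := h.over (A := A)
  obtain ⟨Mod, hMod⟩ := hA.exists_modelCategory M' S' (by rw [hM', hM, rlp_over])
    (by rw [hS', hS, rlp_over])
  have hf (X : Over A) : fibrationsOf Mod (terminal.from X) ↔ An.rlp X.hom :=
    (hMod.fibrant_iff X).trans (rlp_over_terminal_iff An X)
  refine ⟨Mod, hMod, hf, fun Mod' hc hw => ?_, fun Mod' hc hf' => ?_⟩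
  · exact modelCategory_ext (hc.trans hMod.cofibrations_eq.symm)
      (hw.trans hMod.weakEquivalences_eq.symm)
  · refine modelCategory_ext_of_fibrant _ _ (hc.trans hMod.cofibrations_eq.symm) (fun X => ?_)
      fun X => (hf' X).trans (hf X).symm
    rw [hc]
    exact hA.initial_to X

end FunctorialCylinder

end Generators

/-! ### Limits, colimits and presentability of marked simplicial sets. -/

namespace MarkedSSet

open Simplicial MonoidalCategory Opposite

section Limits

variable {J : Type*} [Category J] [HasLimitsOfShape J SSet.{u}] (F : J ⥤ MarkedSSet.{u})

/-- The limit of a diagram of marked simplicial sets, computed on underlying simplicial sets. -/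
noncomputable def limitCone : Cone F where
  pt :=
    { toSSet := limit (F ⋙ forget)
      marked := {e | ∀ j, (limit.π (F ⋙ forget) j).app _ e ∈ (F.obj j).marked}
      degenerate_subset _ he j :=
        (F.obj j).degenerate_subset (SSet.degenerate_app_apply he _) }
  π :=
    { app := fun j => ⟨limit.π (F ⋙ forget) j, fun _ he => he j⟩
      naturality := fun i j f => by
        apply hom_ext
        exact (Category.id_comp _).trans (limit.w (F ⋙ forget) f).symm }

/-- The cone `limitCone F` is a limit. -/
noncomputable def isLimitLimitCone : IsLimit (limitCone F) where
  lift s := ⟨limit.lift (F ⋙ forget) (forget.mapCone s), fun e he j => by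
    have h : (limit.π (F ⋙ forget) j).app _ ((limit.lift (F ⋙ forget) (forget.mapCone s)).app _ e)
        = (s.π.app j).hom.app _ e := by
      change (limit.lift (F ⋙ forget) (forget.mapCone s) ≫ limit.π (F ⋙ forget) j).app _ e = _
      rw [limit.lift_π]
      rfl
    exact h.symm ▸ (s.π.app j).map_marked e he⟩
  fac s j := hom_ext (limit.lift_π (forget.mapCone s) j)
  uniq s m hm := hom_ext (limit.hom_ext fun j => by
    refine Eq.trans ?_ (limit.lift_π (forget.mapCone s) j).symm
    exact congrArg Hom.hom (hm j))

instance : HasLimitsOfShape J MarkedSSet.{u} where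
  has_limit F := ⟨⟨⟨limitCone F, isLimitLimitCone F⟩⟩⟩

end Limits

instance : HasFiniteLimits MarkedSSet.{u} := ⟨fun _ _ _ => inferInstance⟩

instance : HasColimitsOfSize.{u, u} MarkedSSet.{u} := ⟨fun _ _ => inferInstance⟩

section Colimits

variable {J : Type*} [Category J] [HasColimitsOfShape J (Type u)] {F : J ⥤ MarkedSSet.{u}}

instance : PreservesColimitsOfShape J forget.{u} where
  preservesColimit {F} := preservesColimit_of_preserves_colimit_cocone (isColimitColimitCocone F)
    (colimit.isColimit (F ⋙ forget))

theorem exists_app_eq_of_isColimit {c : Cocone F} (hc : IsColimit c) {n : SimplexCategoryᵒᵖ}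
    (x : c.pt.toSSet.obj n) : ∃ (j : J) (y : (F.obj j).toSSet.obj n),
      (c.ι.app j).hom.app n y = x :=
  Types.jointly_surjective_of_isColimit
    (isColimitOfPreserves (forget ⋙ (CategoryTheory.evaluation _ _).obj n) hc) x

/-- Degenerate edges cause no exception: such an edge is the degeneracy of a vertex, which comes
from some stage, and its degeneracy there is marked. -/
theorem exists_marked_of_isColimit {c : Cocone F} (hc : IsColimit c) {e : c.pt.toSSet _⦋1⦌}
    (he : e ∈ c.pt.marked) : ∃ (j : J) (e' : (F.obj j).toSSet _⦋1⦌), e' ∈ (F.obj j).marked ∧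
      (c.ι.app j).hom.app _ e' = e := by
  have key {e : c.pt.toSSet _⦋1⦌} (he : e ∈ c.pt.toSSet.degenerate 1) :
      ∃ (j : J) (e' : (F.obj j).toSSet _⦋1⦌), e' ∈ (F.obj j).marked ∧
        (c.ι.app j).hom.app _ e' = e := by
    rw [SSet.degenerate_eq_iUnion_range_σ] at he
    simp only [Set.mem_iUnion, Set.mem_range] at he
    obtain ⟨k, x, rfl⟩ := he
    obtain ⟨j, y, rfl⟩ := exists_app_eq_of_isColimit hc x
    exact ⟨j, (F.obj j).toSSet.σ k y, (F.obj j).degenerate_subset (SSet.σ_mem_degenerate _ _ _),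
      NatTrans.naturality_apply _ _ _⟩
  let φ := hc.coconePointUniqueUpToIso (isColimitColimitCocone F)
  have hφ (x : c.pt.toSSet _⦋1⦌) : φ.inv.hom.app _ (φ.hom.hom.app _ x) = x :=
    congrArg (fun (f : c.pt ⟶ c.pt) => f.hom.app _ x) φ.hom_inv_id
  obtain h | ⟨j, e', he', h⟩ := φ.hom.map_marked e he
  · refine key ?_
    rw [← hφ e]
    exact SSet.degenerate_app_apply h _
  · refine ⟨j, e', he', ?_⟩
    rw [← hφ e, ← h]
    exact congrArg (fun (f : F.obj j ⟶ c.pt) => f.hom.app _ e')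
      (hc.comp_coconePointUniqueUpToIso_inv (isColimitColimitCocone F) j).symm

end Colimits

theorem isIso_of_reflects_marked {X Y : MarkedSSet.{u}} (f : X ⟶ Y) [IsIso f.hom]
    (hf : ∀ e, f.hom.app _ e ∈ Y.marked → e ∈ X.marked) : IsIso f := by
  refine ⟨⟨inv f.hom, fun e he => hf _ ?_⟩, hom_ext (IsIso.hom_inv_id f.hom),
    hom_ext (IsIso.inv_hom_id f.hom)⟩
  rw [← NatTrans.comp_app_apply, IsIso.inv_hom_id]
  exact he

/-- The morphism `X^♭ ⟶ Y` given by a morphism of simplicial sets. -/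
def ofFlat {X : SSet.{u}} {Y : MarkedSSet.{u}} (f : X ⟶ Y.toSSet) : flat X ⟶ Y :=
  ⟨f, fun _ he => Y.degenerate_subset (SSet.degenerate_app_apply he f)⟩

/-- The morphism `(Δⁿ)^♭ ⟶ X` given by an `n`-simplex of `X`. -/
def ofSimplex {X : MarkedSSet.{u}} {n : SimplexCategory} (x : X.toSSet.obj (op n)) :
    flat (SSet.stdSimplex.obj n) ⟶ X :=
  ofFlat (SSet.yonedaEquiv.symm x)

/-- The only nondegenerate edge of `Δ[1]` is the identity, which is sent to `e`. -/
theorem yonedaEquiv_symm_app_mem {X : MarkedSSet.{u}} {e : X.toSSet _⦋1⦌} (he : e ∈ X.marked)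
    (s : (Δ[1] : SSet.{u}) _⦋1⦌) : (SSet.yonedaEquiv.symm e).app _ s ∈ X.marked := by
  by_cases hs : s ∈ Δ[1].degenerate 1
  · exact X.degenerate_subset (SSet.degenerate_app_apply hs _)
  · rw [SSet.mem_degenerate_iff_notMem_nonDegenerate, not_not,
      SSet.stdSimplex.mem_nonDegenerate_iff_mono] at hs
    obtain ⟨s, rfl⟩ := SSet.stdSimplex.objEquiv.symm.surjective s
    rw [Equiv.apply_symm_apply] at hs
    obtain rfl := SimplexCategory.eq_id_of_mono s
    change SSet.yonedaEquiv (SSet.yonedaEquiv.symm e) ∈ _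
    rwa [Equiv.apply_symm_apply]

/-- The morphism `(Δ¹)^♯ ⟶ X` given by a marked edge of `X`. -/
def ofMarked {X : MarkedSSet.{u}} {e : X.toSSet _⦋1⦌} (he : e ∈ X.marked) : sharp Δ[1] ⟶ X :=
  ⟨SSet.yonedaEquiv.symm e, fun s _ => yonedaEquiv_symm_app_mem he s⟩

/-- The functor `X ↦ X^♭`. -/
def flatFunctor : SSet.{u} ⥤ MarkedSSet.{u} where
  obj := flat
  map := flatMap

/-- The functor `X ↦ X^♭` is left adjoint to the forgetful functor. -/
def flatAdjunction : flatFunctor.{u} ⊣ forget :=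
  Adjunction.mkOfHomEquiv
    { homEquiv _ _ :=
        { toFun f := f.hom
          invFun f := ofFlat f
          left_inv _ := rfl
          right_inv _ := rfl }
      homEquiv_naturality_left_symm _ _ := rfl
      homEquiv_naturality_right _ _ := rfl }

instance (n : SimplexCategory) :
    IsFinitelyPresentable.{u} (flat (SSet.stdSimplex.{u}.obj n)) :=
  have : PreservesColimitsOfSize.{u, u} forget.{u} := ⟨inferInstance⟩
  have := Cardinal.fact_isRegular_aleph0.{u}
  flatAdjunction.isCardinalPresentable_leftAdjoint_obj _ _

instance : IsFinitelyPresentable.{u} (sharp (Δ[1] : SSet.{u})) := by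
  have := Cardinal.fact_isRegular_aleph0.{u}
  refine isCardinalPresentable_of_exists _ _ ?_ ?_
  · intro J _ _ F c hc f
    obtain ⟨j, e, he, h⟩ := exists_marked_of_isColimit hc
      (f.map_marked (SSet.yonedaEquiv (𝟙 _)) (Set.mem_univ _))
    refine ⟨j, ofMarked he, hom_ext ?_⟩
    apply SSet.yonedaEquiv.injective
    refine Eq.trans ?_ h
    exact congrArg ((c.ι.app j).hom.app _) (SSet.yonedaEquiv.apply_symm_apply e)
  · intro J _ _ F c hc j f g h
    have := essentiallySmallSelf J
    obtain ⟨k, u, hu⟩ := IsCardinalPresentable.exists_eq_of_isColimit' (X := (Δ[1] : SSet.{u}))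
      Cardinal.aleph0
      (isColimitOfPreserves forget hc) f.hom g.hom (congrArg Hom.hom h)
    exact ⟨k, u, hom_ext hu⟩

theorem isIso_of_bijective {X Y : SSet.{u}} (f : X ⟶ Y)
    (h : ∀ n, Function.Bijective (f.app n)) : IsIso f := by
  have (n : SimplexCategoryᵒᵖ) : IsIso (f.app n) := (isIso_iff_bijective _).2 (h n)
  exact NatIso.isIso_of_isIso_app f

/-- The finitely presentable objects `(Δⁿ)^♭` and `(Δ¹)^♯` detect isomorphisms: the former see the
simplices, the latter the marked edges. -/
instance : IsLocallyPresentable.{u} MarkedSSet.{u} := by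
  have := Cardinal.fact_isRegular_aleph0.{u}
  let G : ULift.{u} (ℕ ⊕ Unit) → MarkedSSet.{u} := fun x =>
    Sum.elim (fun n => flat Δ[n]) (fun _ => sharp Δ[1]) x.down
  have : ∀ i, IsCardinalPresentable (G i) Cardinal.aleph0.{u} := by
    rintro ⟨n | _⟩
    · exact inferInstanceAs (IsFinitelyPresentable.{u} (flat Δ[n]))
    · exact inferInstanceAs (IsFinitelyPresentable.{u} (sharp Δ[1]))
  refine ⟨Cardinal.aleph0, inferInstance,
    isCardinalLocallyPresentable_of_isDetecting _ G fun X Y f hf => ?_⟩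
  have hf' : ∀ n, Function.Bijective (f.hom.app n) := by
    rintro ⟨n⟩
    induction n using SimplexCategory.rec with | _ n => ?_
    have h := hf _ (ObjectProperty.ofObj.mk (X := G) ⟨Sum.inl n⟩)
    refine ⟨fun x y hxy => ?_, fun y => ?_⟩
    · obtain ⟨z, _, hz⟩ := h (ofSimplex (f.hom.app _ x))
      have h₁ := hz (ofSimplex x) (hom_ext (SSet.yonedaEquiv_symm_comp x f.hom))
      have h₂ := hz (ofSimplex y)
        (hom_ext ((SSet.yonedaEquiv_symm_comp y f.hom).trans (by rw [← hxy]; rfl)))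
      exact SSet.yonedaEquiv.symm.injective (congrArg Hom.hom (h₁.trans h₂.symm))
    · obtain ⟨z, hz, _⟩ := h (ofSimplex y)
      refine ⟨SSet.yonedaEquiv z.hom, ?_⟩
      exact (congrArg (fun k => SSet.yonedaEquiv (Hom.hom k)) hz).trans
        (SSet.yonedaEquiv.apply_symm_apply y)
  have := isIso_of_bijective _ hf'
  refine isIso_of_reflects_marked f fun e he => ?_
  obtain ⟨z, hz, _⟩ := hf _ (ObjectProperty.ofObj.mk (X := G) ⟨Sum.inr ⟨⟩⟩) (ofMarked he)
  have h₁ := (congrArg (fun k => SSet.yonedaEquiv (Hom.hom k)) hz).trans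
    (SSet.yonedaEquiv.apply_symm_apply _)
  rw [← (hf' _).1 h₁]
  exact z.map_marked _ (Set.mem_univ _)

/-! ### The path object, right adjoint to the cylinder. -/

section PathObject

/-- The underlying simplicial set of the path object: its `n`-simplices are the morphisms
`(Δ¹)^♯ × (Δⁿ)^♭ ⟶ W`. -/
def pathSSet (W : MarkedSSet.{u}) : SSet.{u} :=
  (SSet.stdSimplex ⋙ flatFunctor ⋙ cylinder.I).op ⋙ yoneda.obj W

/-- The path object of a marked simplicial set: an edge is marked if all the edges of the
corresponding square are marked. -/
def path (W : MarkedSSet.{u}) : MarkedSSet.{u} where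
  toSSet := pathSSet W
  marked := {z | ∀ s : (Δ[1] ⊗ Δ[1] : SSet.{u}) _⦋1⦌,
    (Hom.hom (X := cylinder.I.obj (flat Δ[1])) z).app _ s ∈ W.marked}
  degenerate_subset z hz s := by
    rw [SSet.degenerate_eq_iUnion_range_σ] at hz
    simp only [Set.mem_iUnion, Set.mem_range] at hz
    obtain ⟨k, z, rfl⟩ := hz
    -- A degenerate edge of the path object factors through `(Δ¹)^♯ × (Δ⁰)^♭`, in which every edge
    -- is marked.
    refine Hom.map_marked (X := cylinder.I.obj (flat Δ[0])) z _ ⟨Set.mem_univ _, ?_⟩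
    exact (SSet.degenerate_eq_univ_of_hasDimensionLT Δ[0] 1 1 le_rfl).ge (Set.mem_univ _)

/-- The morphism `(Δ¹)^♯ × (Δⁿ)^♭ ⟶ W` given by a simplex of the path object. -/
def ofPath {W : MarkedSSet.{u}} {n : SimplexCategory} (z : (path W).toSSet.obj (op n)) :
    cylinder.I.obj (flat (SSet.stdSimplex.obj n)) ⟶ W := z

theorem ofPath_map {W : MarkedSSet.{u}} {m n : SimplexCategory} (θ : m ⟶ n)
    (z : (path W).toSSet.obj (op n)) :
    ofPath ((path W).toSSet.map θ.op z) =
      cylinder.I.map (flatMap (SSet.stdSimplex.map θ)) ≫ ofPath z := rfl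

theorem ofSimplex_map {X : MarkedSSet.{u}} {m n : SimplexCategory} (θ : m ⟶ n)
    (x : X.toSSet.obj (op n)) :
    ofSimplex (X.toSSet.map θ.op x) = flatMap (SSet.stdSimplex.map θ) ≫ ofSimplex x :=
  hom_ext (SSet.yonedaEquiv_symm_naturality_left θ x).symm

/-- The transpose of a morphism `(Δ¹)^♯ × X ⟶ W`. -/
def toPath {X W : MarkedSSet.{u}} (f : cylinder.I.obj X ⟶ W) : X ⟶ path W where
  hom :=
    { app n := ↾fun x => cylinder.I.map (ofSimplex (n := n.unop) x) ≫ f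
      naturality m n θ := by
        ext x
        change cylinder.I.map (ofSimplex (X.toSSet.map θ.unop.op x)) ≫ f =
          cylinder.I.map (flatMap (SSet.stdSimplex.map θ.unop)) ≫ cylinder.I.map (ofSimplex x) ≫ f
        rw [ofSimplex_map, Functor.map_comp, Category.assoc] }
  map_marked e he s := f.map_marked _ ⟨Set.mem_univ _, yonedaEquiv_symm_app_mem he _⟩

/-- The fundamental simplex of `Δⁿ`. -/
def fundamental (n : SimplexCategory) : (SSet.stdSimplex.{u}.obj n).obj (op n) :=
  SSet.stdSimplex.objEquiv.symm (𝟙 n)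

theorem ofSimplex_fundamental {X : MarkedSSet.{u}} {n : SimplexCategory}
    (x : X.toSSet.obj (op n)) : (ofSimplex x).hom.app _ (fundamental n) = x :=
  SSet.yonedaEquiv.apply_symm_apply x

theorem ofPath_app_map {X W : MarkedSSet.{u}} (g : X ⟶ path W) {m n : SimplexCategory}
    (θ : m ⟶ n) (x : X.toSSet.obj (op n)) (e : (Δ[1] : SSet.{u}).obj (op m)) :
    (ofPath (g.hom.app _ (X.toSSet.map θ.op x))).hom.app _ (e, fundamental m) =
      (ofPath (g.hom.app _ x)).hom.app _ (e, (SSet.stdSimplex.obj n).map θ.op (fundamental n)) := by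
  rw [NatTrans.naturality_apply g.hom, ofPath_map]
  rfl

/-- The inverse of `toPath`. -/
def fromPath {X W : MarkedSSet.{u}} (g : X ⟶ path W) : cylinder.I.obj X ⟶ W where
  hom :=
    { app n := ↾fun (x : (Δ[1] ⊗ X.toSSet : SSet.{u}).obj n) =>
        (ofPath (n := n.unop) (g.hom.app n x.2)).hom.app n (x.1, fundamental n.unop)
      naturality m n θ := by
        ext x
        exact (ofPath_app_map g θ.unop x.2 ((Δ[1] : SSet.{u}).map θ x.1)).trans
          (NatTrans.naturality_apply (ofPath (n := m.unop) (g.hom.app m x.2)).hom θ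
            ((x.1, fundamental m.unop) :
              (Δ[1] ⊗ SSet.stdSimplex.obj m.unop : SSet.{u}).obj m)) }
  map_marked x hx := g.map_marked _ hx.2 _

/-- The bijection between morphisms `(Δ¹)^♯ × X ⟶ W` and morphisms from `X` to the path object. -/
def pathEquiv (X W : MarkedSSet.{u}) : (cylinder.I.obj X ⟶ W) ≃ (X ⟶ path W) where
  toFun := toPath
  invFun := fromPath
  left_inv f := by
    apply hom_ext
    ext n x
    exact congrArg (fun y => f.hom.app n (x.1, y)) (ofSimplex_fundamental (n := n.unop) x.2)
  right_inv g := by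
    apply hom_ext
    ext ⟨n⟩ x
    change ofPath (cylinder.I.map (ofSimplex x) ≫ fromPath g) = ofPath (g.hom.app _ x)
    apply hom_ext
    ext ⟨m⟩ ⟨e, s⟩
    obtain ⟨θ, rfl⟩ := SSet.stdSimplex.objEquiv.symm.surjective s
    exact (ofPath_app_map g θ x e).trans (congrArg
      (fun s => (ofPath (g.hom.app _ x)).hom.app _ (e, s))
      (congrArg SSet.stdSimplex.objEquiv.symm (Category.comp_id θ)))

instance : cylinder.{u}.I.IsLeftAdjoint :=
  (Adjunction.adjunctionOfEquivRight pathEquiv fun X' X Y f g => by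
    apply hom_ext
    ext ⟨n⟩ x
    change ofPath (cylinder.I.map (ofSimplex x) ≫ cylinder.I.map f ≫ g) =
      ofPath (cylinder.I.map (ofSimplex (f.hom.app _ x)) ≫ g)
    refine (Category.assoc _ _ _).symm.trans (congrArg (· ≫ g) ?_)
    exact (cylinder.I.map_comp _ _).symm.trans
      (congrArg cylinder.I.map (hom_ext (SSet.yonedaEquiv_symm_comp x f.hom)))).isLeftAdjoint

end PathObject

/-! ### Monomorphisms, their generators and corner maps. -/

theorem underlyingMono_iff {X Y : MarkedSSet.{u}} (f : X ⟶ Y) :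
    underlyingMono f ↔ ∀ n, Function.Injective (f.hom.app n) := by
  simp only [← mono_iff_injective, ← NatTrans.mono_iff_mono_app]
  rfl

theorem exists_pushout_eq {X Y Z : MarkedSSet.{u}} (f : X ⟶ Y) (g : X ⟶ Z) {n : SimplexCategoryᵒᵖ}
    (x : (pushout f g).toSSet.obj n) :
    (∃ y, (pushout.inl f g).hom.app n y = x) ∨ ∃ z, (pushout.inr f g).hom.app n z = x := by
  obtain ⟨j, y, h⟩ := exists_app_eq_of_isColimit (pushoutIsPushout f g) x
  obtain _ | _ | _ := j
  · exact .inl ⟨f.hom.app n y, h⟩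
  · exact .inl ⟨y, h⟩
  · exact .inr ⟨y, h⟩

theorem exists_coprod_eq {X Y : MarkedSSet.{u}} {n : SimplexCategoryᵒᵖ}
    (x : (X ⨿ Y).toSSet.obj n) :
    (∃ y, (coprod.inl (X := X) (Y := Y)).hom.app n y = x) ∨
      ∃ z, (coprod.inr (X := X) (Y := Y)).hom.app n z = x := by
  obtain ⟨⟨j⟩, y, h⟩ := exists_app_eq_of_isColimit (coprodIsCoprod X Y) x
  obtain _ | _ := j
  · exact .inl ⟨y, h⟩
  · exact .inr ⟨y, h⟩

/-- In each degree, the two pieces of the pushout embed in `G L`, and the last hypothesis says that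
their images meet only in what comes from `F K`, where they are glued. -/
theorem underlyingMono_boxMap {F G : MarkedSSet.{u} ⥤ MarkedSSet.{u}} (η : F ⟶ G)
    {K L : MarkedSSet.{u}} (i : K ⟶ L) (h₁ : underlyingMono (η.app L))
    (h₂ : underlyingMono (G.map i))
    (h : ∀ (n : SimplexCategoryᵒᵖ) (x : (F.obj L).toSSet.obj n) (y : (G.obj K).toSSet.obj n),
      (η.app L).hom.app n x = (G.map i).hom.app n y →
      ∃ z, (F.map i).hom.app n z = x ∧ (η.app K).hom.app n z = y) :
    underlyingMono (boxMap η i) := by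
  rw [underlyingMono_iff] at h₁ h₂ ⊢
  intro n
  have e₁ (x) : (boxMap η i).hom.app n ((pushout.inl (F.map i) (η.app K)).hom.app n x) =
      (η.app L).hom.app n x :=
    congrArg (fun f : F.obj L ⟶ G.obj L => f.hom.app n x) (inl_boxMap η i)
  have e₂ (x) : (boxMap η i).hom.app n ((pushout.inr (F.map i) (η.app K)).hom.app n x) =
      (G.map i).hom.app n x :=
    congrArg (fun f : G.obj K ⟶ G.obj L => f.hom.app n x) (inr_boxMap η i)
  have key (x : (F.obj L).toSSet.obj n) (y : (G.obj K).toSSet.obj n)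
      (hxy : (η.app L).hom.app n x = (G.map i).hom.app n y) :
      (pushout.inl (F.map i) (η.app K)).hom.app n x =
        (pushout.inr (F.map i) (η.app K)).hom.app n y := by
    obtain ⟨z, rfl, rfl⟩ := h n x y hxy
    exact congrArg (fun f : F.obj K ⟶ pushout (F.map i) (η.app K) => f.hom.app n z)
      pushout.condition
  intro a b hab
  obtain ⟨x, rfl⟩ | ⟨x, rfl⟩ := exists_pushout_eq _ _ a <;>
    obtain ⟨y, rfl⟩ | ⟨y, rfl⟩ := exists_pushout_eq _ _ b
  · rw [e₁, e₁] at hab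
    rw [h₁ n hab]
  · rw [e₁, e₂] at hab
    exact key x y hab
  · rw [e₁, e₂] at hab
    exact (key y x hab.symm).symm
  · rw [e₂, e₂] at hab
    rw [h₂ n hab]

theorem underlyingMono_cylinder_map {K L : MarkedSSet.{u}} {i : K ⟶ L} (hi : underlyingMono i) :
    underlyingMono (cylinder.I.map i) := by
  rw [underlyingMono_iff] at hi ⊢
  intro n x y h
  exact Prod.ext (congrArg Prod.fst h :) (hi n (congrArg Prod.snd h))

/-- The natural transformation given by the inclusions at a vertex. -/
def vertexInclusionNatTrans (k : Fin 2) : 𝟭 MarkedSSet.{u} ⟶ cylinder.I where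
  app := vertexInclusion k

theorem vertexInclusion_app_eq {k : Fin 2} {K L : MarkedSSet.{u}} {i : K ⟶ L}
    {n : SimplexCategoryᵒᵖ} {x : L.toSSet.obj n} {y : (cylinder.I.obj K).toSSet.obj n}
    (h : (vertexInclusion k L).hom.app n x = (cylinder.I.map i).hom.app n y) :
    (vertexInclusion k K).hom.app n y.2 = y := by
  have h₁ := congrArg Prod.fst h
  exact Prod.ext h₁ rfl

theorem underlyingMono_boxMap_vertexInclusion (k : Fin 2) {K L : MarkedSSet.{u}} {i : K ⟶ L}
    (hi : underlyingMono i) : underlyingMono (boxMap (vertexInclusionNatTrans k) i) := by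
  refine underlyingMono_boxMap _ i ?_ (underlyingMono_cylinder_map hi) ?_
  · rw [underlyingMono_iff]
    intro n x y h
    exact congrArg Prod.snd h
  · intro n x y h
    exact ⟨y.2, (congrArg Prod.snd h).symm, vertexInclusion_app_eq h⟩

theorem vertexInclusion_app_ne {X : MarkedSSet.{u}} {n : SimplexCategoryᵒᵖ}
    (x y : X.toSSet.obj n) :
    (vertexInclusion 0 X).hom.app n x ≠ (vertexInclusion 1 X).hom.app n y := by
  intro h
  have h : (SSet.const (SSet.stdSimplex.obj₀Equiv.symm 0) : X.toSSet ⟶ Δ[1]).app n x =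
      (SSet.const (SSet.stdSimplex.obj₀Equiv.symm 1) : X.toSSet ⟶ Δ[1]).app n y :=
    congrArg Prod.fst h
  have h' := congrArg (fun s => (SSet.stdSimplex.objEquiv s).toOrderHom 0) h
  exact Fin.zero_ne_one h'

theorem inl_boundary_app {X : MarkedSSet.{u}} {n : SimplexCategoryᵒᵖ} (x : X.toSSet.obj n) :
    (cylinder.boundary.app X).hom.app n ((coprod.inl (X := X) (Y := X)).hom.app n x) =
      (vertexInclusion 0 X).hom.app n x :=
  congrArg (fun f : X ⟶ cylinder.I.obj X => f.hom.app n x) (coprod.inl_desc _ _)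

theorem inr_boundary_app {X : MarkedSSet.{u}} {n : SimplexCategoryᵒᵖ} (x : X.toSSet.obj n) :
    (cylinder.boundary.app X).hom.app n ((coprod.inr (X := X) (Y := X)).hom.app n x) =
      (vertexInclusion 1 X).hom.app n x :=
  congrArg (fun f : X ⟶ cylinder.I.obj X => f.hom.app n x) (coprod.inr_desc _ _)

theorem underlyingMono_boxMap_boundary {K L : MarkedSSet.{u}} {i : K ⟶ L}
    (hi : underlyingMono i) : underlyingMono (boxMap cylinder.boundary i) := by
  refine underlyingMono_boxMap _ i ?_ (underlyingMono_cylinder_map hi) ?_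
  · rw [underlyingMono_iff]
    intro n (a : (L ⨿ L).toSSet.obj n) (b : (L ⨿ L).toSSet.obj n) h
    obtain ⟨x, rfl⟩ | ⟨x, rfl⟩ := exists_coprod_eq a <;>
      obtain ⟨y, rfl⟩ | ⟨y, rfl⟩ := exists_coprod_eq b
    · rw [inl_boundary_app, inl_boundary_app] at h
      rw [show x = y from congrArg Prod.snd h]
    · rw [inl_boundary_app, inr_boundary_app] at h
      exact (vertexInclusion_app_ne _ _ h).elim
    · rw [inl_boundary_app, inr_boundary_app] at h
      exact (vertexInclusion_app_ne _ _ h.symm).elim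
    · rw [inr_boundary_app, inr_boundary_app] at h
      rw [show x = y from congrArg Prod.snd h]
  · intro n (a : (L ⨿ L).toSSet.obj n) y h
    obtain ⟨x, rfl⟩ | ⟨x, rfl⟩ := exists_coprod_eq a
    · rw [inl_boundary_app] at h
      refine ⟨(coprod.inl (X := K) (Y := K)).hom.app n y.2, ?_, ?_⟩
      · refine (congrArg (fun f : K ⟶ L ⨿ L => f.hom.app n y.2) (coprod.inl_map i i)).trans ?_
        exact congrArg ((coprod.inl (X := L) (Y := L)).hom.app n) (congrArg Prod.snd h).symm
      · exact (inl_boundary_app _).trans (vertexInclusion_app_eq h)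
    · rw [inr_boundary_app] at h
      refine ⟨(coprod.inr (X := K) (Y := K)).hom.app n y.2, ?_, ?_⟩
      · refine (congrArg (fun f : K ⟶ L ⨿ L => f.hom.app n y.2) (coprod.inr_map i i)).trans ?_
        exact congrArg ((coprod.inr (X := L) (Y := L)).hom.app n) (congrArg Prod.snd h).symm
      · exact (inr_boundary_app _).trans (vertexInclusion_app_eq h)

theorem underlyingMono_of_isInitial {X Y : MarkedSSet.{u}} (h : IsInitial X) (f : X ⟶ Y) :
    underlyingMono f := by
  rw [underlyingMono_iff]
  intro n x
  obtain ⟨⟨⟨⟩⟩, _⟩ := exists_app_eq_of_isColimit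
    ((isColimitEquivIsInitialOfIsEmpty _ (asEmptyCocone X)).symm h) x

instance : MorphismProperty.HasSmallObjectArgument.{u} SSet.modelCategoryQuillen.I.{u} := by
  have := Cardinal.fact_isRegular_aleph0.{u}
  have := Cardinal.orderBotAleph0OrdToType.{u}
  have : MorphismProperty.IsCardinalForSmallObjectArgument SSet.modelCategoryQuillen.I.{u}
      Cardinal.aleph0.{u} :=
    { isSmall := MorphismProperty.isSmall_ofHoms _
      preservesColimit {A B X Y} i hi f hf := by
        have : IsFinitelyPresentable.{u} A := by
          obtain ⟨n⟩ := hi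
          infer_instance
        infer_instance }
  exact ⟨Cardinal.aleph0.{u}, inferInstance, inferInstance, this⟩

theorem modelCategoryQuillen_I_rlp_llp_le :
    SSet.modelCategoryQuillen.I.{u}.rlp.llp ≤ MorphismProperty.monomorphisms SSet.{u} := by
  rw [MorphismProperty.llp_rlp_of_hasSmallObjectArgument, MorphismProperty.retracts_le_iff,
    MorphismProperty.transfiniteCompositions_le_iff, MorphismProperty.pushouts_le_iff,
    MorphismProperty.coproducts_le_iff]
  exact SSet.modelCategoryQuillen.I_le_monomorphisms

theorem generatingMono_le : generatingMono.{u} ≤ underlyingMono := by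
  rintro _ _ _ (n | _)
  · exact inferInstanceAs (Mono (SSet.boundary.{u} n).ι)
  · exact inferInstanceAs (Mono (𝟙 (Δ[1] : SSet.{u})))

theorem innerHornsAndJ_le : innerHornsAndJ.{u} ≤ underlyingMono := by
  rintro _ _ _ (⟨n, k, _, _, _⟩ | _)
  · exact inferInstanceAs (Mono (SSet.horn.{u} n k).ι)
  · exact inferInstanceAs (Mono (𝟙 SSet.coherentIso.{u}))

theorem rlp_underlyingMono {X Y : MarkedSSet.{u}} {p : X ⟶ Y}
    (h : (MorphismProperty.monomorphisms SSet.{u}).rlp p.hom)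
    (h' : ∀ e, p.hom.app _ e ∈ Y.marked → e ∈ X.marked) : underlyingMono.rlp p := by
  intro K L i hi
  refine ⟨fun {a b} sq => ?_⟩
  obtain ⟨l, h₁, h₂⟩ := exists_lift (h i.hom hi) (congrArg Hom.hom sq.w)
  refine ⟨⟨⟨l, fun e he => h' _ ?_⟩, hom_ext h₁, hom_ext h₂⟩⟩
  rw [← NatTrans.comp_app_apply, h₂]
  exact b.map_marked e he

/-- Both sides describe the maps that are trivial fibrations on underlying simplicial sets and
reflect marked edges; the latter is what lifting against `(Δ¹)^♭ ⟶ (Δ¹)^♯` means. -/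
theorem generatingMono_rlp : generatingMono.{u}.rlp = underlyingMono.rlp := by
  refine le_antisymm (fun X Y p hp => rlp_underlyingMono ?_ fun e he => ?_)
    (MorphismProperty.antitone_rlp generatingMono_le)
  · rw [SSet.rlp_monomorphisms]
    rintro _ _ _ ⟨n⟩
    refine ⟨fun {a b} sq => ?_⟩
    obtain ⟨l, h₁, h₂⟩ := exists_lift (hp _ (.boundary n)) (a := ofFlat a) (b := ofFlat b)
      (hom_ext sq.w)
    exact ⟨⟨l.hom, congrArg Hom.hom h₁, congrArg Hom.hom h₂⟩⟩
  · obtain ⟨l, h₁, h₂⟩ := exists_lift (hp _ .edge) (a := ofSimplex e) (b := ofMarked he)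
      (hom_ext (SSet.yonedaEquiv_symm_comp e p.hom))
    have := l.map_marked (fundamental ⦋1⦌) (Set.mem_univ _)
    rwa [show l.hom.app _ (fundamental ⦋1⦌) = e from (congrArg
      (fun f : flat Δ[1] ⟶ X => f.hom.app _ (fundamental ⦋1⦌)) h₁).trans
        (ofSimplex_fundamental e)] at this

instance : MorphismProperty.IsSmall.{u} generatingMono.{u} := by
  let s (x : Option ℕ) : Arrow MarkedSSet.{u} := x.elim
    (Arrow.mk (flatToSharp (SSet.stdSimplex.{u}.obj ⦋1⦌)))
    (fun n => Arrow.mk (flatMap (SSet.boundary.{u} n).ι))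
  have hs {K L : MarkedSSet.{u}} (i : K ⟶ L) (hi : generatingMono i) :
      Arrow.mk i ∈ Set.range s := by
    obtain n | _ := hi
    · exact ⟨some n, rfl⟩
    · exact ⟨none, rfl⟩
  exact ⟨small_subset fun f hf => hs f.hom hf⟩

instance : MorphismProperty.IsSmall.{u} innerHornsAndJ.{u} := by
  let s (x : Option (Σ n : ℕ, Fin (n + 1))) : Arrow MarkedSSet.{u} := x.elim
    (Arrow.mk (flatToSharp SSet.coherentIso.{u}))
    (fun x => Arrow.mk (flatMap (SSet.horn.{u} x.1 x.2).ι))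
  have hs {K L : MarkedSSet.{u}} (i : K ⟶ L) (hi : innerHornsAndJ i) :
      Arrow.mk i ∈ Set.range s := by
    obtain ⟨n, k, _, _, _⟩ | _ := hi
    · exact ⟨some ⟨n, k⟩, rfl⟩
    · exact ⟨none, rfl⟩
  exact ⟨small_subset fun f hf => hs f.hom hf⟩

theorem isWeakFactorizationSystem_underlyingMono :
    underlyingMono.{u}.IsWeakFactorizationSystem underlyingMono.rlp := by
  have : underlyingMono.{u}.IsStableUnderRetracts :=
    inferInstanceAs ((MorphismProperty.monomorphisms SSet.{u}).inverseImage
      forget).IsStableUnderRetracts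
  have : underlyingMono.{u}.HasFactorization underlyingMono.rlp :=
    ⟨fun {X Y} f => by
      let d := MorphismProperty.factorizationData SSet.modelCategoryQuillen.I.{u}.rlp.llp
        SSet.modelCategoryQuillen.I.{u}.rlp f.hom
      -- All edges over marked edges of `Y` are marked, so that the second factor reflects markings.
      let Z : MarkedSSet.{u} :=
        { toSSet := d.Z
          marked := {e | d.p.app _ e ∈ Y.marked}
          degenerate_subset _ he := Y.degenerate_subset (SSet.degenerate_app_apply he _) }
      exact ⟨{
        Z := Z
        i := ⟨d.i, fun e he => by
          change d.p.app _ (d.i.app _ e) ∈ Y.marked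
          rw [← NatTrans.comp_app_apply, d.fac]
          exact f.map_marked e he⟩
        p := ⟨d.p, fun _ he => he⟩
        fac := hom_ext d.fac
        hi := modelCategoryQuillen_I_rlp_llp_le _ d.hi
        hp := rlp_underlyingMono (by rw [SSet.rlp_monomorphisms]; exact d.hp) fun _ he => he }⟩⟩
  exact .mk' _ _ fun i p hi hp => hp i hi

theorem isHomotopical_markedRightAnodyne :
    cylinder.{u}.IsHomotopical underlyingMono markedRightAnodyne :=
  cylinder.isHomotopical_of_boxMap cylinder
    (fun _ _ h => cylinder.endpointLifting_of_boxMap h)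
    (fun _ _ h => cylinder.boundaryLifting_of_boxMap h)
    isWeakFactorizationSystem_underlyingMono generatingMono_rlp innerHornsAndJ_le
    (fun _ hi => underlyingMono_boxMap_vertexInclusion 1 hi)
    (fun _ hi => underlyingMono_boxMap_boundary hi)
    (fun _ => underlyingMono_of_isInitial initialIsInitial _)

instance : cylinder.{u}.symm.I.IsLeftAdjoint := inferInstanceAs cylinder.I.IsLeftAdjoint

theorem isHomotopical_markedLeftAnodyne :
    cylinder.{u}.symm.IsHomotopical underlyingMono markedLeftAnodyne :=
  cylinder.isHomotopical_of_boxMap cylinder.symm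
    (fun _ _ h => cylinder.symm.endpointLifting_of_boxMap h)
    (fun _ _ h => (cylinder.boundaryLifting_of_boxMap h).symm)
    isWeakFactorizationSystem_underlyingMono generatingMono_rlp innerHornsAndJ_le
    (fun _ hi => underlyingMono_boxMap_vertexInclusion 0 hi)
    (fun _ hi => underlyingMono_boxMap_boundary hi)
    (fun _ => underlyingMono_of_isInitial initialIsInitial _)

end MarkedSSet

end DirectedHomotopy

open DirectedHomotopy in
theorem mainTheorem6 (A : MarkedSSet.{u}) :
    (∃ M : ModelCategory (Over A),
      IsInducedModelStructure (MarkedSSet.cylinder.overCylinder A) MarkedSSet.underlyingMono.over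
        MarkedSSet.markedRightAnodyne.over M ∧
      (∀ X : Over A, fibrationsOf M (terminal.from X) ↔
        MarkedSSet.markedRightAnodyne.rlp X.hom) ∧
      (∀ M' : ModelCategory (Over A),
        cofibrationsOf M' = MarkedSSet.underlyingMono.over →
        weakEquivalencesOf M' =
          (MarkedSSet.cylinder.overCylinder A).equivalences MarkedSSet.markedRightAnodyne.over →
        M' = M) ∧
      (∀ M' : ModelCategory (Over A),
        cofibrationsOf M' = MarkedSSet.underlyingMono.over →
        (∀ X : Over A, fibrationsOf M' (terminal.from X) ↔
          MarkedSSet.markedRightAnodyne.rlp X.hom) →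
        M' = M)) ∧
    (∃ M : ModelCategory (Over A),
      IsInducedModelStructure (MarkedSSet.cylinder.overCylinder A) MarkedSSet.underlyingMono.over
        MarkedSSet.markedLeftAnodyne.over M ∧
      (∀ X : Over A, fibrationsOf M (terminal.from X) ↔
        MarkedSSet.markedLeftAnodyne.rlp X.hom) ∧
      (∀ M' : ModelCategory (Over A),
        cofibrationsOf M' = MarkedSSet.underlyingMono.over →
        weakEquivalencesOf M' =
          (MarkedSSet.cylinder.overCylinder A).equivalences MarkedSSet.markedLeftAnodyne.over →
        M' = M) ∧
      (∀ M' : ModelCategory (Over A),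
        cofibrationsOf M' = MarkedSSet.underlyingMono.over →
        (∀ X : Over A, fibrationsOf M' (terminal.from X) ↔
          MarkedSSet.markedLeftAnodyne.rlp X.hom) →
        M' = M)) := by
  refine ⟨MarkedSSet.isHomotopical_markedRightAnodyne.exists_modelCategory_over
    MarkedSSet.generatingMono _ MarkedSSet.generatingMono_rlp
    (MorphismProperty.rlp_llp_rlp _).symm A, ?_⟩
  obtain ⟨M, h₁, h₂, h₃, h₄⟩ :=
    MarkedSSet.isHomotopical_markedLeftAnodyne.exists_modelCategory_over
      MarkedSSet.generatingMono _ MarkedSSet.generatingMono_rlp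
      (MorphismProperty.rlp_llp_rlp _).symm A
  -- The left structure was built from the exchanged cylinder, whose weak equivalences are the same.
  have h := (MarkedSSet.cylinder.overCylinder A).equivalences_symm
    (An := MarkedSSet.markedLeftAnodyne.over)
  exact ⟨M, ⟨h₁.1, h₁.2.trans h, h₁.3, h₁.4⟩, h₂, fun M' hc hw => h₃ M' hc (hw.trans h.symm), h₄⟩
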